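/- **Theorem (connectivity in the adjacency array model with $O(n)$ expected queries).** An undirected simple graph $G$ on vertices $\{0,\dots,n-1\}$, $n\ge 1$, is given in the *array model*: the degrees $d_i$ are known, and for each vertex $i$ the array $f_i:\{0,\dots,d_i-1\}\to\{0,\dots,n-1\}$, which lists the neighbours of $i$ without repetition in an arbitrary order, can be accessed only by queries. A classical query reveals one entry $f_i(j)$; a quantum query applies the unitary $|i,j\rangle|b\rangle\mapsto|i,j\rangle|b\oplus f_i(j)\rangle$. For a set $C$ of vertices let $m_C=\sum_{i\in C}d_i$. Consider the following algorithm. 1. *Preprocessing.* Start with $A=\emptyset$ and $S=V$. While $S\neq\emptyset$: take $v\in S$ of highest degree, set $D=\{v\}$, and query the neighbours $w$ of $v$ one by one, each time adding the edge $\{v,w\}$ to $A$ and $w$ to $D$, until the list ends or a neighbour $w\notin S$ is met; then remove $D$ from $S$. 2. *Main loop.* While the graph $(V,A)$ is not connected: let $C$ be a connected component of $(V,A)$ with smallest $m_C$. Search by quantum search with an unknown number of solutions for an edge of $G$ that leaves $C$, and add it to $A$. The search proceeds in rounds $r=0,1,2,\dots$: choose an integer $j$ with $0\le j<\min\{(6/5)^r,\sqrt{m_C}\}$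 uniformly at random, apply $j$ Grover iterations (two queries each) to the uniform superposition of the $m_C$ array entries of the vertices of $C$, where the entries holding a vertex outside $C$ are marked, measure, and check the entry found with one classical query; stop at the first success. If $m_C=0$, the search never stops. 3. Output $A$. There is an absolute constant $c$ such that for all $n\ge1$ and every $G$ as above the following hold. * The preprocessing is purely classical, makes at most $n$ queries, and ends with a set $A$ of edges of $G$ such that every connected component $C$ of $(V,A)$ satisfies $m_C\le|C|^2$. * If $G$ is connected, then with probability $1$ the algorithm halts and outputs the edge set of a spanning tree of $G$, and the expected total number of queries is at most $c\,n$. * If $G$ is not connected, then the algorithm runs forever: for every $t$, the probability that it has halted after $t$ steps is $0$. -/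

import Mathlib

open scoped ENNReal

noncomputable section

/-! ### The adjacency array model -/

/-- An undirected simple graph on the vertex set `Fin n` in the adjacency array model: the degrees,
and for every vertex `i` an array `nbr i` listing its neighbours without repetition in an arbitrary
order. -/
structure AdjArray (n : ℕ) where
  deg : Fin n → ℕ
  nbr : (i : Fin n) → Fin (deg i) → Fin n
  nbr_injective : ∀ i, Function.Injective (nbr i)
  nbr_symm : ∀ i i', (∃ j, nbr i j = i') → ∃ j', nbr i' j' = i
  nbr_ne : ∀ i j, nbr i j ≠ i

/-- The graph encoded by the arrays. -/
def AdjArray.graph {n : ℕ} (G : AdjArray n) : SimpleGraph (Fin n) where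
  Adj i i' := ∃ j, G.nbr i j = i'
  symm := ⟨fun i i' h => G.nbr_symm i i' h⟩
  loopless := ⟨fun i ⟨j, hj⟩ => G.nbr_ne i j hj⟩

/-- Positions `(i, j)` of array cells; cell `(i, j)` holds the `j`-th neighbour of `i`. -/
abbrev Cell {n : ℕ} (d : Fin n → ℕ) : Type := Σ i : Fin n, Fin (d i)

/-- The black box: the contents of the array cells. -/
def AdjArray.oracle {n : ℕ} (G : AdjArray n) (x : Cell G.deg) : Fin n := G.nbr x.1 x.2

/-! ### Quantum circuits with oracle gates -/

/-- The binary encoding of a vertex. -/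
def encode {n : ℕ} (v : Fin n) : Fin n.size → Bool := fun k => v.val.testBit k

/-- Computational basis states `|x, b⟩` of the quantum register: a query part `x` holding an
array position, and an answer part `b` of `⌊log₂ n⌋ + 1` qubits. -/
abbrev Basis {n : ℕ} (d : Fin n → ℕ) : Type := Cell d × (Fin n.size → Bool)

/-- The state space of the quantum register. -/
abbrev QState {n : ℕ} (d : Fin n → ℕ) : Type := EuclideanSpace ℂ (Basis d)

/-- The action `|x, b⟩ ↦ |x, b ⊕ f x⟩` of the oracle on the basis states. -/
def oraclePerm {n : ℕ} {d : Fin n → ℕ} (f : Cell d → Fin n) : Equiv.Perm (Basis d) where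
  toFun z := (z.1, fun k => xor (z.2 k) (encode (f z.1) k))
  invFun z := (z.1, fun k => xor (z.2 k) (encode (f z.1) k))
  left_inv z := by ext <;> simp
  right_inv z := by ext <;> simp

/-- The oracle as a unitary operator. -/
def oracleUnitary {n : ℕ} {d : Fin n → ℕ} (f : Cell d → Fin n) : QState d ≃ₗᵢ[ℂ] QState d :=
  LinearIsometryEquiv.piLpCongrLeft 2 ℂ ℂ (oraclePerm f)

/-- A gate is a fixed unitary, which does not depend on the arrays, or one query. -/
inductive Gate {n : ℕ} (d : Fin n → ℕ) : Type
  | unitary (U : QState d ≃ₗᵢ[ℂ] QState d)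
  | query

def Gate.toUnitary {n : ℕ} {d : Fin n → ℕ} (f : Cell d → Fin n) :
    Gate d → (QState d ≃ₗᵢ[ℂ] QState d)
  | .unitary U => U
  | .query => oracleUnitary f

def Gate.queries {n : ℕ} {d : Fin n → ℕ} : Gate d → ℕ
  | .unitary _ => 0
  | .query => 1

/-- A finite circuit: a fixed initial state, followed by a list of gates (first gate at the head);
at the end the whole register is measured. -/
structure Circuit {n : ℕ} (d : Fin n → ℕ) where
  init : QState d
  norm_init : ‖init‖ = 1
  gates : List (Gate d)

/-- The number of queries made by a circuit. -/
def Circuit.queries {n : ℕ} {d : Fin n → ℕ} (K : Circuit d) : ℕ :=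
  (K.gates.map Gate.queries).sum

/-- The state of the register before the final measurement. -/
def Circuit.final {n : ℕ} {d : Fin n → ℕ} (K : Circuit d) (f : Cell d → Fin n) : QState d :=
  K.gates.foldl (fun ψ g => g.toUnitary f ψ) K.init

theorem Circuit.norm_final {n : ℕ} {d : Fin n → ℕ} (K : Circuit d) (f : Cell d → Fin n) :
    ‖K.final f‖ = 1 := by
  have key : ∀ (l : List (Gate d)) (ψ : QState d),
      ‖l.foldl (fun ψ g => g.toUnitary f ψ) ψ‖ = ‖ψ‖ := by
    intro l
    induction l with
    | nil => intro ψ; rfl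
    | cons g l ih => intro ψ; rw [List.foldl_cons, ih, LinearIsometryEquiv.norm_map]
  rw [Circuit.final, key, K.norm_init]

/-- The distribution of the outcome when the final state is measured in the computational basis. -/
def Circuit.outcome {n : ℕ} {d : Fin n → ℕ} (K : Circuit d) (f : Cell d → Fin n) :
    PMF (Basis d) :=
  PMF.ofFintype (fun z => ENNReal.ofReal (‖K.final f z‖ ^ 2)) <| by
    rw [← ENNReal.ofReal_sum_of_nonneg (fun _ _ => by positivity),
      ← EuclideanSpace.norm_sq_eq, K.norm_final]
    simp

/-! ### Quantum query algorithms with classical control -/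

/-- One step of the classical control: stop with an output, move on, move on at random, make a
classical query, or run a quantum circuit and learn the outcome of its measurement. -/
inductive QAction {n : ℕ} (d : Fin n → ℕ) (Ctl Out : Type) : Type
  | halt (a : Out)
  | goto (c : Ctl)
  | coin (p : PMF Ctl)
  | ask (x : Cell d) (k : Fin n → Ctl)
  | run (K : Circuit d) (k : Basis d → Ctl)

/-- A quantum query algorithm for arrays with degrees `d`. The arrays are not accessible to `start`
and `action`: they are used only by the steps `ask` and `run`. -/
structure QAlgorithm {n : ℕ} (d : Fin n → ℕ) (Out : Type) where
  Ctl : Type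
  start : Ctl
  action : Ctl → QAction d Ctl Out

namespace QAlgorithm

variable {n : ℕ} {d : Fin n → ℕ} {Out : Type}

/-- The distribution of the control state after one step; a halted computation does not move. -/
def next (M : QAlgorithm d Out) (f : Cell d → Fin n) (c : M.Ctl) : PMF M.Ctl :=
  match M.action c with
  | .halt _ => PMF.pure c
  | .goto c' => PMF.pure c'
  | .coin p => p
  | .ask x k => PMF.pure (k (f x))
  | .run K k => (K.outcome f).map k

/-- The number of queries made by the step that is taken in control state `c`. -/
def queries (M : QAlgorithm d Out) (c : M.Ctl) : ℕ :=
  match M.action c with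
  | .halt _ => 0
  | .goto _ => 0
  | .coin _ => 0
  | .ask _ _ => 1
  | .run K _ => K.queries

/-- The step taken in control state `c` uses no quantum circuit. -/
def ClassicalAt (M : QAlgorithm d Out) (c : M.Ctl) : Prop :=
  match M.action c with
  | .run _ _ => False
  | _ => True

/-- The distribution of the control state after `t` steps. -/
def law (M : QAlgorithm d Out) (f : Cell d → Fin n) : ℕ → PMF M.Ctl
  | 0 => PMF.pure M.start
  | t + 1 => (law M f t).bind (M.next f)

/-- The probability that after `t` steps the algorithm has halted with an output in `P`. -/
def haltProb (M : QAlgorithm d Out) (f : Cell d → Fin n) (P : Set Out) (t : ℕ) : ℝ≥0∞ :=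
  (M.law f t).toOuterMeasure {c | ∃ a ∈ P, M.action c = .halt a}

/-- The probability that the algorithm ever halts with an output in `P`. -/
def outputProb (M : QAlgorithm d Out) (f : Cell d → Fin n) (P : Set Out) : ℝ≥0∞ :=
  ⨆ t, M.haltProb f P t

/-- The expected number of queries made in step `t`, counting from `0`. -/
def stepQueries (M : QAlgorithm d Out) (f : Cell d → Fin n) (t : ℕ) : ℝ≥0∞ :=
  ∑' c, M.law f t c * (M.queries c : ℝ≥0∞)

/-- The expected number of queries made in the whole run. -/
def expectedQueries (M : QAlgorithm d Out) (f : Cell d → Fin n) : ℝ≥0∞ :=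
  ∑' t, M.stepQueries f t

end QAlgorithm

/-! ### Components and spanning trees -/

/-- The graph with edge set `A`. -/
abbrev edgeGraph {n : ℕ} (A : Finset (Sym2 (Fin n))) : SimpleGraph (Fin n) :=
  SimpleGraph.fromEdgeSet (A : Set (Sym2 (Fin n)))

open Classical in
/-- The vertex set of the connected component of `u` with respect to the edge set `A`. -/
def component {n : ℕ} (A : Finset (Sym2 (Fin n))) (u : Fin n) : Finset (Fin n) :=
  Finset.univ.filter fun v => (edgeGraph A).Reachable u v

/-- The total degree of a set of vertices. -/
def totalDeg {n : ℕ} (d : Fin n → ℕ) (C : Finset (Fin n)) : ℕ := ∑ i ∈ C, d i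

/-- `A` is the edge set of a spanning tree of `G`. -/
def IsSpanningTree {n : ℕ} (G : SimpleGraph (Fin n)) (A : Finset (Sym2 (Fin n))) : Prop :=
  (A : Set (Sym2 (Fin n))) ⊆ G.edgeSet ∧ (edgeGraph A).IsTree

/-! ### Quantum search for an edge leaving a component -/

/-- The uniform superposition `m_C^{-1/2} ∑ |x, 0⟩` over the array cells `x` of the vertices in
`C`. -/
def uniformState {n : ℕ} (d : Fin n → ℕ) (C : Finset (Fin n)) : QState d :=
  WithLp.toLp 2 fun z =>
    if z.1.1 ∈ C ∧ z.2 = fun _ => false then (((Real.sqrt (totalDeg d C))⁻¹ : ℝ) : ℂ) else 0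

theorem norm_uniformState {n : ℕ} (d : Fin n → ℕ) (C : Finset (Fin n)) (h : 0 < totalDeg d C) :
    ‖uniformState d C‖ = 1 := by
  have h0 : (0 : ℝ) < totalDeg d C := by exact_mod_cast h
  have hc : ∑ x : Cell d, (if x.1 ∈ C then ((totalDeg d C : ℝ))⁻¹ else 0) = 1 := by
    have hi : ∀ i : Fin n, ∑ _j : Fin (d i), (if i ∈ C then ((totalDeg d C : ℝ))⁻¹ else 0) =
        if i ∈ C then (d i : ℝ) * ((totalDeg d C : ℝ))⁻¹ else 0 := by
      intro i
      split_ifs <;> simp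
    rw [Fintype.sum_sigma, Finset.sum_congr rfl fun i _ => hi i, ← Finset.sum_filter,
      ← Finset.sum_mul, Finset.filter_univ_mem, ← Nat.cast_sum]
    exact mul_inv_cancel₀ h0.ne'
  have hsq : ‖uniformState d C‖ ^ 2 = 1 := by
    rw [EuclideanSpace.norm_sq_eq, Fintype.sum_prod_type, ← hc]
    refine Finset.sum_congr rfl fun x _ => ?_
    rw [Finset.sum_eq_single (fun _ => false)]
    · by_cases hx : x.1 ∈ C
      · simp [uniformState, hx, Real.sq_sqrt h0.le]
      · simp [uniformState, hx]
    · intro b _ hb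
      simp [uniformState, hb]
    · simp
  have hn := norm_nonneg (uniformState d C)
  nlinarith

open Classical in
/-- The operator that multiplies `|x, b⟩` by `-1` if `b` does not encode a vertex of `C`, and by `1`
otherwise. -/
def flipOutside {n : ℕ} (d : Fin n → ℕ) (C : Finset (Fin n)) : QState d ≃ₗᵢ[ℂ] QState d :=
  LinearIsometryEquiv.piLpCongrRight 2 fun z : Basis d =>
    if ∀ v ∈ C, z.2 ≠ encode v then LinearIsometryEquiv.neg ℂ else LinearIsometryEquiv.refl ℂ ℂ

/-- The inversion about the average, `2|s⟩⟨s| - 1` with `s` the uniform superposition. -/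
def diffusion {n : ℕ} (d : Fin n → ℕ) (C : Finset (Fin n)) : QState d ≃ₗᵢ[ℂ] QState d :=
  (Submodule.span ℂ {uniformState d C}).reflection

/-- `j` Grover iterations on the uniform superposition. The marked cells are those that hold a
vertex outside `C`; each iteration makes two queries, to compute the cell content and to uncompute
it. -/
def groverCircuit {n : ℕ} (d : Fin n → ℕ) (C : Finset (Fin n)) (h : 0 < totalDeg d C) (j : ℕ) :
    Circuit d where
  init := uniformState d C
  norm_init := norm_uniformState d C h
  gates := (List.replicate j
    [.query, .unitary (flipOutside d C), .query, .unitary (diffusion d C)]).flatten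

/-- The bound `min (λ ^ r) √N`, with `λ = 6 / 5`, on the number of Grover iterations in round `r` of
the search with an unknown number of solutions among `N` elements. -/
def roundBound (N r : ℕ) : ℝ := min ((6 / 5 : ℝ) ^ r) (Real.sqrt N)

theorem range_roundBound_nonempty {N : ℕ} (h : 0 < N) (r : ℕ) :
    (Finset.range ⌈roundBound N r⌉₊).Nonempty := by
  rw [Finset.nonempty_range_iff, Ne, Nat.ceil_eq_zero, not_le]
  have : (0 : ℝ) < N := by exact_mod_cast h
  exact lt_min (by positivity) (Real.sqrt_pos.2 this)

/-! ### The connectivity algorithm -/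

/-- The control states. `A` is always the set of edges selected so far. -/
inductive CState {n : ℕ} (d : Fin n → ℕ) : Type
  /-- Preprocessing; `S` is the set of vertices not yet placed in a component. -/
  | place (S : Finset (Fin n)) (A : Finset (Sym2 (Fin n)))
  /-- Preprocessing; the first `j` neighbours of `v` have been read and lie in `D`. -/
  | scan (S : Finset (Fin n)) (A : Finset (Sym2 (Fin n))) (v : Fin n) (D : Finset (Fin n)) (j : ℕ)
  /-- Head of the main loop. -/
  | loop (A : Finset (Sym2 (Fin n)))
  /-- Beginning of round `r` of the search for an edge out of `C`. -/
  | search (A : Finset (Sym2 (Fin n))) (C : Finset (Fin n)) (r : ℕ)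
  /-- Round `r` of the search; `j` Grover iterations are to be made. -/
  | grover (A : Finset (Sym2 (Fin n))) (C : Finset (Fin n)) (r j : ℕ)
  /-- Round `r` of the search; the cell `x` was measured and is to be checked. -/
  | check (A : Finset (Sym2 (Fin n))) (C : Finset (Fin n)) (r : ℕ) (x : Cell d)

/-- A vertex of highest degree in `S`. -/
def highestDegree {n : ℕ} (d : Fin n → ℕ) (S : Finset (Fin n)) (h : S.Nonempty) : Fin n :=
  (S.exists_max_image d h).choose

/-- A connected component of `A` of smallest total degree. -/
def lightestComponent {n : ℕ} [NeZero n] (d : Fin n → ℕ) (A : Finset (Sym2 (Fin n))) :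
    Finset (Fin n) :=
  component A (Function.argmin fun u => totalDeg d (component A u))

open Classical in
/-- The steps of the algorithm.

* `place`, `scan`: as long as `S` is non-empty, take a vertex `v` of highest degree in `S` and read
  its neighbours one by one, adding each of them to `D` and its edge to `A`, until the list ends or
  a neighbour outside `S` is met, which is a vertex that already belongs to a component. Then remove
  `D` from `S`. The components constructed are those of the graph with edge set `A`.
* `loop`: if `A` connects the graph, output `A`; otherwise search for an edge out of the component
  of `A` of smallest total degree.
* `search`, `grover`, `check`: in round `r` choose `j` uniformly among the integers
  `0 ≤ j < min (λ ^ r) √m_C`, apply `j` Grover iterations to the uniform superposition of the `m_C`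
  array cells of `C`, measure, and check the cell found with a classical query. If it gives an edge
  out of `C`, add the edge to `A`, otherwise go to the next round. If there is nothing to search
  (`m_C = 0`), stay forever. -/
def connectivityAction {n : ℕ} [NeZero n] (d : Fin n → ℕ) :
    CState d → QAction d (CState d) (Finset (Sym2 (Fin n)))
  | .place S A =>
      if h : S.Nonempty then .goto (.scan S A (highestDegree d S h) {highestDegree d S h} 0)
      else .goto (.loop A)
  | .scan S A v D j =>
      if h : j < d v then
        .ask ⟨v, j, h⟩ fun w =>
          if w ∈ S then .scan S (insert s(v, w) A) v (insert w D) (j + 1)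
          else .place (S \ D) (insert s(v, w) A)
      else .goto (.place (S \ D) A)
  | .loop A =>
      if (edgeGraph A).Connected then .halt A
      else .goto (.search A (lightestComponent d A) 0)
  | .search A C r =>
      if h : 0 < totalDeg d C then
        .coin ((PMF.uniformOfFinset _ (range_roundBound_nonempty h r)).map fun j =>
          .grover A C r j)
      else .goto (.search A C r)
  | .grover A C r j =>
      if h : 0 < totalDeg d C then .run (groverCircuit d C h j) fun z => .check A C r z.1
      else .goto (.search A C r)
  | .check A C r x =>
      .ask x fun w =>
        if w ∈ C then .search A C (r + 1) else .loop (insert s(x.1, w) A)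

/-- The connectivity algorithm in the array model. -/
def connectivityAlgorithm {n : ℕ} [NeZero n] (d : Fin n → ℕ) :
    QAlgorithm d (Finset (Sym2 (Fin n))) where
  Ctl := CState d
  start := .place Finset.univ ∅
  action := connectivityAction d

end

/-! ### Expectations and Lyapunov functions -/

/-! Everything quantitative comes from a Lyapunov function. Charge one unit for each query and one
for each step of a run that has not halted. On a connected graph, `costBound` dominates the charge
of the current step plus its own expected value after that step (`costBound_step`), so by
telescoping (`QAlgorithm.tsum_expect_le`) the expected total charge is at most the value at the
start, which is at most 127n. This bounds the queries. It also gives termination with probability 1: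
the probability of not having halted at time t is at most the expected charge at time t, the general
term of a convergent series. Correctness is the invariant `Inv`: the selected edges always form a
forest in the graph, and the run halts only when they connect all vertices, which is impossible in a
disconnected graph.

Preprocessing. Every query of a phase, except possibly the last, brings a new vertex into D, so a
phase makes at most |D| queries before D is removed from S. Each placed component has more vertices
than the degree of any unplaced vertex. If the list of v ends, |D| exceeds deg v, the maximal degree
in D, so m_D ≤ |D|². If D is attached to a placed component K, then m_D ≤ |D| deg v ≤ |D||K| and m_K
≤ |K|², so the union still satisfies the bound.

Search. With sin²θ the marked fraction of the cells, j Grover iterations fail with probability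
cos²((2j+1)θ). Averaged over at least √N values of j, with N cells of which at least one is marked,
this is at most 3/4. The early rounds have geometrically growing cost, the late ones cost O(√N) and
succeed with constant probability; altogether a search costs O(√N), as recorded by `searchCost`.

Main loop. The potential is Φ = Σ √m_C over the components, at most n after the preprocessing
because √m_C ≤ |C|. Joining the lightest component C to another one lowers Φ by at least √m_C / 2
(`potential_insert`), which pays for the search out of C. -/

namespace PMF

/-- The expectation of an extended nonnegative function. -/
noncomputable def expect {α : Type*} (p : PMF α) (V : α → ℝ≥0∞) : ℝ≥0∞ := ∑' a, p a * V a

variable {α β : Type*}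

@[simp]
theorem expect_pure (a : α) (V : α → ℝ≥0∞) : (PMF.pure a).expect V = V a := by
  classical
  rw [expect, tsum_eq_single a]
  · simp
  · intro b hb
    simp [hb]

theorem expect_bind (p : PMF α) (q : α → PMF β) (V : β → ℝ≥0∞) :
    (p.bind q).expect V = p.expect fun a => (q a).expect V := by
  simp only [expect, PMF.bind_apply, ← ENNReal.tsum_mul_right, ← ENNReal.tsum_mul_left]
  rw [ENNReal.tsum_comm]
  simp only [mul_assoc]

theorem expect_map (p : PMF α) (g : α → β) (V : β → ℝ≥0∞) :
    (p.map g).expect V = p.expect fun a => V (g a) := by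
  rw [← PMF.bind_pure_comp, expect_bind]
  simp

theorem expect_mono (p : PMF α) {V W : α → ℝ≥0∞} (h : ∀ a ∈ p.support, V a ≤ W a) :
    p.expect V ≤ p.expect W := by
  refine ENNReal.tsum_le_tsum fun a => ?_
  by_cases ha : p a = 0
  · simp [ha]
  · gcongr
    exact h a ((p.mem_support_iff a).2 ha)

theorem expect_add (p : PMF α) (V W : α → ℝ≥0∞) :
    (p.expect fun a => V a + W a) = p.expect V + p.expect W := by
  simp only [expect, mul_add]
  exact ENNReal.tsum_add

theorem expect_mul_right (p : PMF α) (V : α → ℝ≥0∞) (r : ℝ≥0∞) :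
    (p.expect fun a => V a * r) = p.expect V * r := by
  simp only [expect, ← ENNReal.tsum_mul_right, mul_assoc]

@[simp]
theorem expect_const (p : PMF α) (r : ℝ≥0∞) : (p.expect fun _ => r) = r := by
  simp [expect, ENNReal.tsum_mul_right, p.tsum_coe]

theorem expect_uniformOfFinset (s : Finset α) (hs : s.Nonempty) (V : α → ℝ≥0∞) :
    (PMF.uniformOfFinset s hs).expect V = (s.card : ℝ≥0∞)⁻¹ * ∑ a ∈ s, V a := by
  classical
  rw [expect, tsum_eq_sum (s := s) fun a ha => by simp [PMF.uniformOfFinset_apply_of_notMem hs ha],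
    Finset.mul_sum]
  exact Finset.sum_congr rfl fun a ha => by rw [PMF.uniformOfFinset_apply_of_mem hs ha]

theorem toOuterMeasure_eq_expect (p : PMF α) (s : Set α) :
    p.toOuterMeasure s = p.expect (s.indicator 1) := by
  rw [PMF.toOuterMeasure_apply, expect]
  refine tsum_congr fun a => ?_
  by_cases h : a ∈ s <;> simp [h]

end PMF

/-! ### Invariants, cost bounds and almost sure termination for general algorithms. -/

namespace QAlgorithm

variable {n : ℕ} {d : Fin n → ℕ} {Out : Type}

/-- The computation has halted in control state `c`. -/
def Halted (M : QAlgorithm d Out) (c : M.Ctl) : Prop := ∃ a, M.action c = .halt a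

theorem law_invariant (M : QAlgorithm d Out) (f : Cell d → Fin n) (Inv : M.Ctl → Prop)
    (hstart : Inv M.start) (hstep : ∀ c, Inv c → ∀ c' ∈ (M.next f c).support, Inv c') (t : ℕ) :
    ∀ c ∈ (M.law f t).support, Inv c := by
  induction t with
  | zero =>
    intro c hc
    rw [law, PMF.support_pure, Set.mem_singleton_iff] at hc
    exact hc ▸ hstart
  | succ t ih =>
    intro c hc
    rw [law, PMF.mem_support_bind_iff] at hc
    obtain ⟨b, hb, hc⟩ := hc
    exact hstep b (ih b hb) c hc

/-- A function that drops in expectation by at least the cost of every step bounds the expected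
total cost. -/
theorem tsum_expect_le (M : QAlgorithm d Out) (f : Cell d → Fin n) (Inv : M.Ctl → Prop)
    (hstart : Inv M.start) (hstep : ∀ c, Inv c → ∀ c' ∈ (M.next f c).support, Inv c')
    (cost V : M.Ctl → ℝ≥0∞) (hV : ∀ c, Inv c → cost c + (M.next f c).expect V ≤ V c) :
    ∑' t, (M.law f t).expect cost ≤ V M.start := by
  have key : ∀ t, ∑ s ∈ Finset.range t, (M.law f s).expect cost + (M.law f t).expect V
      ≤ V M.start := by
    intro t
    induction t with
    | zero => simp [law]
    | succ t ih =>
      rw [Finset.sum_range_succ, add_assoc]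
      refine le_trans ?_ ih
      gcongr
      rw [law, PMF.expect_bind, ← PMF.expect_add]
      exact PMF.expect_mono _ fun c hc => hV c (law_invariant M f Inv hstart hstep t c hc)
  rw [ENNReal.tsum_eq_iSup_nat]
  exact iSup_le fun t => le_trans le_self_add (key t)

theorem expectedQueries_le (M : QAlgorithm d Out) (f : Cell d → Fin n) (cost : M.Ctl → ℝ≥0∞)
    (hc : ∀ c, (M.queries c : ℝ≥0∞) ≤ cost c) :
    M.expectedQueries f ≤ ∑' t, (M.law f t).expect cost :=
  ENNReal.tsum_le_tsum fun _ => PMF.expect_mono _ fun c _ => hc c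

/-- If the expected number of steps is finite and every output belongs to `P`, then the algorithm
halts with probability one with an output in `P`. -/
theorem outputProb_eq_one (M : QAlgorithm d Out) (f : Cell d → Fin n) (P : Set Out)
    (Inv : M.Ctl → Prop) (hstart : Inv M.start)
    (hstep : ∀ c, Inv c → ∀ c' ∈ (M.next f c).support, Inv c')
    (hP : ∀ c, Inv c → ∀ a, M.action c = .halt a → a ∈ P) (cost : M.Ctl → ℝ≥0∞)
    (hc : ∀ c, ¬ M.Halted c → 1 ≤ cost c) (hfin : ∑' t, (M.law f t).expect cost ≠ ∞) :
    M.outputProb f P = 1 := by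
  -- At each time every reachable state either has halted with an output in `P` or has cost at least
  -- 1, so the two expectations together are at least 1. The second one tends to 0.
  have h1 : ∀ t, 1 ≤ M.haltProb f P t + (M.law f t).expect cost := by
    intro t
    rw [haltProb, PMF.toOuterMeasure_eq_expect, ← PMF.expect_add]
    refine le_trans (PMF.expect_const (M.law f t) 1).ge (PMF.expect_mono _ fun c hcs => ?_)
    by_cases hh : M.Halted c
    · obtain ⟨a, ha⟩ := hh
      have hmem : c ∈ {c | ∃ a ∈ P, M.action c = .halt a} :=
        ⟨a, hP c (law_invariant M f Inv hstart hstep t c hcs) a ha, ha⟩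
      rw [Set.indicator_of_mem hmem]
      exact le_self_add
    · exact le_trans (hc c hh) le_add_self
  have h0 := ENNReal.tendsto_atTop_zero_of_tsum_ne_top hfin
  refine le_antisymm (iSup_le fun t => ?_) ?_
  · rw [haltProb, PMF.toOuterMeasure_eq_expect]
    refine le_trans (PMF.expect_mono _ (W := fun _ => 1) fun c _ => ?_) (PMF.expect_const _ 1).le
    exact Set.indicator_le_self _ _ c
  · refine ge_of_tendsto' (x := Filter.atTop) (f := fun t => M.outputProb f P +
      (M.law f t).expect cost) (by simpa using tendsto_const_nhds.add h0) fun t => ?_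
    refine le_trans (h1 t) ?_
    gcongr
    exact le_iSup (fun t => M.haltProb f P t) t

end QAlgorithm

/-! ### The success probability of the search -/

namespace Grover

variable {n : ℕ} {d : Fin n → ℕ}

/-- A vertex is smaller than n, hence smaller than 2 to the power `n.size`, so the bits beyond the
register vanish. -/
theorem encode_injective : Function.Injective (encode (n := n)) := by
  intro v w h
  refine Fin.ext (Nat.eq_of_testBit_eq fun k => ?_)
  by_cases hk : k < n.size
  · exact congrFun h ⟨k, hk⟩
  · have hn : ∀ x : Fin n, x.val.testBit k = false := fun x =>
      Nat.testBit_lt_two_pow (x.isLt.trans ((Nat.lt_size_self n).trans_le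
        (Nat.pow_le_pow_right two_pos (not_lt.1 hk))))
    rw [hn, hn]

/-- The number of cells of `C` that hold a vertex outside `C`. -/
def markedCount (f : Cell d → Fin n) (C : Finset (Fin n)) : ℕ :=
  (Finset.univ.filter fun x : Cell d => x.1 ∈ C ∧ f x ∉ C).card

/-- The number of cells of `C` that hold a vertex of `C`. -/
def unmarkedCount (f : Cell d → Fin n) (C : Finset (Fin n)) : ℕ :=
  (Finset.univ.filter fun x : Cell d => x.1 ∈ C ∧ f x ∈ C).card

theorem sum_cells {R : Type*} [Semiring R] (f : Cell d → Fin n) (C : Finset (Fin n)) (a b : R) :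
    (∑ x : Cell d, if x.1 ∈ C then (if f x ∈ C then b else a) else 0) =
      markedCount f C * a + unmarkedCount f C * b := by
  have h : ∀ x : Cell d, (if x.1 ∈ C then (if f x ∈ C then b else a) else 0) =
      (if x.1 ∈ C ∧ f x ∉ C then a else 0) + (if x.1 ∈ C ∧ f x ∈ C then b else 0) := by
    intro x
    by_cases h1 : x.1 ∈ C <;> by_cases h2 : f x ∈ C <;> simp [h1, h2]
  rw [Finset.sum_congr rfl fun x _ => h x, Finset.sum_add_distrib, ← Finset.sum_filter,
    ← Finset.sum_filter, Finset.sum_const, Finset.sum_const, nsmul_eq_mul, nsmul_eq_mul]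
  rfl

theorem markedCount_add_unmarkedCount (f : Cell d → Fin n) (C : Finset (Fin n)) :
    markedCount f C + unmarkedCount f C = totalDeg d C := by
  have h := sum_cells f C (1 : ℕ) 1
  simp only [ite_self, mul_one, Nat.cast_id] at h
  rw [← h, Fintype.sum_sigma, totalDeg, ← Finset.filter_univ_mem C, Finset.sum_filter]
  refine Finset.sum_congr rfl fun i _ => ?_
  by_cases hi : i ∈ C <;> simp [hi]

/-- The state with amplitude `a` at the marked and `b` at the unmarked cells of `C`. -/
noncomputable def cellState (f : Cell d → Fin n) (C : Finset (Fin n)) (a b : ℝ) : QState d :=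
  WithLp.toLp 2 fun z =>
    if z.1.1 ∈ C ∧ z.2 = fun _ => false then (if f z.1 ∈ C then (b : ℂ) else (a : ℂ)) else 0

theorem cellState_apply (f : Cell d → Fin n) (C : Finset (Fin n)) (a b : ℝ) (z : Basis d) :
    cellState f C a b z =
      if z.1.1 ∈ C ∧ z.2 = fun _ => false then (if f z.1 ∈ C then (b : ℂ) else (a : ℂ)) else 0 :=
  rfl

theorem uniformState_eq_cellState (f : Cell d → Fin n) (C : Finset (Fin n)) :
    uniformState d C =
      cellState f C (Real.sqrt (totalDeg d C))⁻¹ (Real.sqrt (totalDeg d C))⁻¹ := by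
  ext z
  rw [cellState_apply, ite_self]
  rfl

theorem sum_basis {R : Type*} [AddCommMonoid R] (g : Basis d → R)
    (h : ∀ z : Basis d, z.2 ≠ (fun _ => false) → g z = 0) :
    ∑ z, g z = ∑ x, g (x, fun _ => false) := by
  rw [Fintype.sum_prod_type]
  refine Finset.sum_congr rfl fun x _ => ?_
  exact Finset.sum_eq_single _ (fun b _ hb => h (x, b) hb) (by simp)

theorem inner_uniformState (f : Cell d → Fin n) (C : Finset (Fin n)) (a b : ℝ) :
    inner ℂ (uniformState d C) (cellState f C a b) =
      (((Real.sqrt (totalDeg d C))⁻¹ * (markedCount f C * a + unmarkedCount f C * b) : ℝ) : ℂ) := by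
  rw [PiLp.inner_apply, sum_basis _ fun z hz => by simp [cellState_apply, hz]]
  have h : ∀ x : Cell d, inner ℂ (uniformState d C (x, fun _ => false))
      (cellState f C a b (x, fun _ => false)) =
      (((Real.sqrt (totalDeg d C))⁻¹ *
        (if x.1 ∈ C then (if f x ∈ C then b else a) else 0) : ℝ) : ℂ) := by
    intro x
    rw [uniformState_eq_cellState f]
    by_cases h1 : x.1 ∈ C <;> by_cases h2 : f x ∈ C <;> simp [cellState_apply, h1, h2, mul_comm]
  rw [Finset.sum_congr rfl fun x _ => h x, ← Complex.ofReal_sum, ← Finset.mul_sum, sum_cells]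

/-- The reflection in the uniform superposition replaces each amplitude on the cells of `C` by twice
the mean amplitude minus itself. -/
theorem diffusion_cellState (f : Cell d → Fin n) (C : Finset (Fin n)) (h : 0 < totalDeg d C)
    (a b : ℝ) : diffusion d C (cellState f C a b) =
      cellState f C (2 * ((markedCount f C * a + unmarkedCount f C * b) / totalDeg d C) - a)
        (2 * ((markedCount f C * a + unmarkedCount f C * b) / totalDeg d C) - b) := by
  have h0 : (0 : ℝ) < totalDeg d C := by exact_mod_cast h
  have hs : Real.sqrt (totalDeg d C) * Real.sqrt (totalDeg d C) = totalDeg d C :=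
    Real.mul_self_sqrt h0.le
  have hd : (markedCount f C * a + unmarkedCount f C * b) / totalDeg d C =
      (Real.sqrt (totalDeg d C))⁻¹ * (markedCount f C * a + unmarkedCount f C * b) *
        (Real.sqrt (totalDeg d C))⁻¹ := by
    rw [← hs, div_eq_mul_inv, mul_inv]
    simp only [hs]
    ring
  rw [diffusion, Submodule.reflection_singleton_apply, inner_uniformState, norm_uniformState d C h,
    hd]
  ext z
  rw [uniformState_eq_cellState f]
  by_cases h1 : z.1.1 ∈ C ∧ z.2 = fun _ => false <;> by_cases h2 : f z.1 ∈ C <;>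
    simp [cellState_apply, h1, h2]

theorem oracleUnitary_apply (f : Cell d → Fin n) (ψ : QState d) (z : Basis d) :
    oracleUnitary f ψ z = ψ (oraclePerm f z) := by
  rfl

/-- The first query writes the content of the cell into the blank answer register, the phase flip
reads it there, and the second query erases it. The net effect is a sign on the marked cells. -/
theorem oracle_flip_oracle (f : Cell d → Fin n) (C : Finset (Fin n)) (a b : ℝ) :
    oracleUnitary f (flipOutside d C (oracleUnitary f (cellState f C a b))) =
      cellState f C (-a) b := by
  classical
  have hflip : ∀ (ψ : QState d) (z : Basis d), flipOutside d C ψ z =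
      if ∀ v ∈ C, z.2 ≠ encode v then -ψ z else ψ z := by
    intro ψ z
    rw [flipOutside, LinearIsometryEquiv.piLpCongrRight_apply]
    show (if ∀ v ∈ C, z.2 ≠ encode v then LinearIsometryEquiv.neg ℂ
      else LinearIsometryEquiv.refl ℂ ℂ) (ψ z) = _
    split_ifs <;> rfl
  ext z
  have hz : oraclePerm f (oraclePerm f z) = z := (oraclePerm f).left_inv z
  rw [oracleUnitary_apply, hflip, oracleUnitary_apply, hz]
  by_cases h0 : z.2 = fun _ => false
  · have he : (oraclePerm f z).2 = encode (f z.1) := by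
      funext k
      simp [oraclePerm, h0]
    have hiff : (∀ v ∈ C, (oraclePerm f z).2 ≠ encode v) ↔ f z.1 ∉ C := by
      rw [he]
      refine ⟨fun h hc => h _ hc rfl, fun h v hv hvv => h ?_⟩
      rwa [encode_injective hvv]
    simp only [hiff]
    by_cases h1 : z.1.1 ∈ C <;> by_cases h2 : f z.1 ∈ C <;> simp [cellState_apply, h1, h2, h0]
  · simp [cellState_apply, h0]

theorem final_succ (f : Cell d → Fin n) (C : Finset (Fin n)) (h : 0 < totalDeg d C) (j : ℕ) :
    (groverCircuit d C h (j + 1)).final f =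
      diffusion d C (oracleUnitary f (flipOutside d C (oracleUnitary f
        ((groverCircuit d C h j).final f)))) := by
  simp only [Circuit.final, groverCircuit, List.replicate_succ', List.flatten_append,
    List.foldl_append]
  rfl

theorem queries_groverCircuit (C : Finset (Fin n)) (h : 0 < totalDeg d C) (j : ℕ) :
    (groverCircuit d C h j).queries = 2 * j := by
  induction j with
  | zero => rfl
  | succ j ih =>
    simp only [Circuit.queries, groverCircuit, List.replicate_succ', List.flatten_append,
      List.map_append, List.sum_append] at ih ⊢
    rw [ih]
    simp [Gate.queries]
    ring

/-- The state after `j` Grover iterations. -/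
theorem final_eq (f : Cell d → Fin n) (C : Finset (Fin n)) (h : 0 < totalDeg d C) (θ : ℝ)
    (hsin : Real.sqrt (markedCount f C) = Real.sqrt (totalDeg d C) * Real.sin θ)
    (hcos : Real.sqrt (unmarkedCount f C) = Real.sqrt (totalDeg d C) * Real.cos θ) (j : ℕ) :
    -- The relations are multiplied by the square roots of the counts so that they stay meaningful
    -- when one class of cells is empty; the corresponding amplitude is then arbitrary.
    ∃ a b : ℝ, (groverCircuit d C h j).final f = cellState f C a b ∧
      Real.sqrt (markedCount f C) * a = Real.sin ((2 * j + 1) * θ) ∧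
      Real.sqrt (unmarkedCount f C) * b = Real.cos ((2 * j + 1) * θ) := by
  have h0 : (0 : ℝ) < totalDeg d C := by exact_mod_cast h
  have hN : 0 < Real.sqrt (totalDeg d C) := Real.sqrt_pos.2 h0
  have hNN : Real.sqrt (totalDeg d C) * Real.sqrt (totalDeg d C) = totalDeg d C :=
    Real.mul_self_sqrt h0.le
  induction j with
  | zero =>
    refine ⟨_, _, uniformState_eq_cellState f C, ?_, ?_⟩
    · rw [hsin]
      field_simp
      simp
    · rw [hcos]
      field_simp
      simp
  | succ j ih =>
    obtain ⟨a, b, hf, ha, hb⟩ := ih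
    have hm : (markedCount f C : ℝ) * a =
        Real.sqrt (totalDeg d C) * Real.sin θ * Real.sin ((2 * j + 1) * θ) := by
      rw [← ha, ← hsin, ← mul_assoc, Real.mul_self_sqrt (Nat.cast_nonneg _)]
    have hu : (unmarkedCount f C : ℝ) * b =
        Real.sqrt (totalDeg d C) * Real.cos θ * Real.cos ((2 * j + 1) * θ) := by
      rw [← hb, ← hcos, ← mul_assoc, Real.mul_self_sqrt (Nat.cast_nonneg _)]
    -- After the sign flip the mean amplitude is cos((2j+2)θ)/√N. The sum formulas for the angles
    -- (2j+2)θ ± θ then turn the update of `a` and `b` into a rotation by 2θ.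
    have hmean : Real.sqrt (totalDeg d C) *
        ((markedCount f C * -a + unmarkedCount f C * b) / totalDeg d C) =
        Real.cos ((2 * j + 2) * θ) := by
      rw [show ((2 * j + 2) * θ : ℝ) = θ + (2 * j + 1) * θ by ring, Real.cos_add, mul_neg, hm, hu,
        mul_div_assoc', div_eq_iff h0.ne']
      linear_combination (Real.cos θ * Real.cos ((2 * j + 1) * θ) -
        Real.sin θ * Real.sin ((2 * j + 1) * θ)) * hNN
    refine ⟨_, _, by rw [final_succ, hf, oracle_flip_oracle, diffusion_cellState f C h], ?_, ?_⟩
    · have : Real.sin ((2 * (j + 1 : ℕ) + 1) * θ) =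
          2 * Real.sin θ * Real.cos ((2 * j + 2) * θ) + Real.sin ((2 * j + 1) * θ) := by
        push_cast
        rw [show ((2 * (j + 1) + 1) * θ : ℝ) = (2 * j + 2) * θ + θ by ring,
          show ((2 * j + 1) * θ : ℝ) = (2 * j + 2) * θ - θ by ring, Real.sin_add, Real.sin_sub]
        ring
      rw [this, ← ha, ← hmean, hsin]
      ring
    · have : Real.cos ((2 * (j + 1 : ℕ) + 1) * θ) =
          2 * Real.cos θ * Real.cos ((2 * j + 2) * θ) - Real.cos ((2 * j + 1) * θ) := by
        push_cast
        rw [show ((2 * (j + 1) + 1) * θ : ℝ) = (2 * j + 2) * θ + θ by ring,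
          show ((2 * j + 1) * θ : ℝ) = (2 * j + 2) * θ - θ by ring, Real.cos_add, Real.cos_sub]
        ring
      rw [this, ← hb, ← hmean, hcos]
      ring

theorem exists_angle (f : Cell d → Fin n) (C : Finset (Fin n)) (h : 0 < totalDeg d C) :
    ∃ θ : ℝ, Real.sqrt (markedCount f C) = Real.sqrt (totalDeg d C) * Real.sin θ ∧
      Real.sqrt (unmarkedCount f C) = Real.sqrt (totalDeg d C) * Real.cos θ := by
  have h0 : (0 : ℝ) < totalDeg d C := by exact_mod_cast h
  have hN : 0 < Real.sqrt (totalDeg d C) := Real.sqrt_pos.2 h0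
  have hsum : (markedCount f C : ℝ) + unmarkedCount f C = totalDeg d C := by
    exact_mod_cast markedCount_add_unmarkedCount f C
  have hle : Real.sqrt (markedCount f C) / Real.sqrt (totalDeg d C) ≤ 1 := by
    rw [div_le_one hN]
    exact Real.sqrt_le_sqrt (by rw [← hsum]; simp)
  refine ⟨Real.arcsin (Real.sqrt (markedCount f C) / Real.sqrt (totalDeg d C)), ?_, ?_⟩
  · rw [Real.sin_arcsin (le_trans (by norm_num : (-1 : ℝ) ≤ 0) (by positivity)) hle]
    field_simp
  · rw [Real.cos_arcsin, div_pow, Real.sq_sqrt (Nat.cast_nonneg _), Real.sq_sqrt h0.le,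
      ← Real.sqrt_mul h0.le]
    congr 1
    field_simp
    linarith

/-- Needed also when the search fails: the invariant requires the cell to be checked to belong to a
vertex of `C`, so that an accepted edge starts in `C`. -/
theorem outcome_support (f : Cell d → Fin n) (C : Finset (Fin n)) (h : 0 < totalDeg d C) (j : ℕ)
    (z : Basis d) (hz : z ∈ ((groverCircuit d C h j).outcome f).support) : z.1.1 ∈ C := by
  obtain ⟨θ, hs, hc⟩ := exists_angle f C h
  obtain ⟨a, b, hf, -, -⟩ := final_eq f C h θ hs hc j
  by_contra hC
  rw [PMF.mem_support_iff] at hz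
  apply hz
  rw [Circuit.outcome, PMF.ofFintype_apply, hf, cellState_apply]
  simp [hC]

/-- The probability of measuring an unmarked cell. -/
noncomputable def failProb (f : Cell d → Fin n) (C : Finset (Fin n)) (h : 0 < totalDeg d C)
    (j : ℕ) : ℝ≥0∞ :=
  ((groverCircuit d C h j).outcome f).expect fun z => if f z.1 ∈ C then 1 else 0

theorem failProb_le_one (f : Cell d → Fin n) (C : Finset (Fin n)) (h : 0 < totalDeg d C)
    (j : ℕ) : failProb f C h j ≤ 1 := by
  refine le_trans (PMF.expect_mono _ (W := fun _ => 1) fun z _ => ?_) (PMF.expect_const _ 1).le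
  split_ifs <;> simp

theorem failProb_eq (f : Cell d → Fin n) (C : Finset (Fin n)) (h : 0 < totalDeg d C) (θ : ℝ)
    (hsin : Real.sqrt (markedCount f C) = Real.sqrt (totalDeg d C) * Real.sin θ)
    (hcos : Real.sqrt (unmarkedCount f C) = Real.sqrt (totalDeg d C) * Real.cos θ) (j : ℕ) :
    failProb f C h j = ENNReal.ofReal (Real.cos ((2 * j + 1) * θ) ^ 2) := by
  obtain ⟨a, b, hf, -, hb⟩ := final_eq f C h θ hsin hcos j
  rw [failProb, PMF.expect, tsum_fintype]
  have h1 : ∀ z : Basis d, (groverCircuit d C h j).outcome f z * (if f z.1 ∈ C then 1 else 0) =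
      ENNReal.ofReal (if z.2 = (fun _ => false) then
        (if z.1.1 ∈ C then (if f z.1 ∈ C then b ^ 2 else 0) else 0) else 0) := by
    intro z
    rw [Circuit.outcome, PMF.ofFintype_apply, hf, cellState_apply]
    by_cases h1 : z.1.1 ∈ C <;> by_cases h2 : f z.1 ∈ C <;>
      by_cases h3 : z.2 = (fun _ => false) <;> simp [h1, h2, h3]
  rw [Finset.sum_congr rfl fun z _ => h1 z, ← ENNReal.ofReal_sum_of_nonneg,
    sum_basis _ fun z hz => by simp [hz], ← hb, mul_pow, Real.sq_sqrt (Nat.cast_nonneg _)]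
  · simp only [if_true]
    rw [sum_cells f C (0 : ℝ) (b ^ 2)]
    simp
  · intro z _
    split_ifs <;> positivity

/-- The double-angle formula makes the sum telescope to m/2 + sin(4mθ)/(4 sin 2θ); the denominator
is cleared so that no assumption on θ is needed. -/
theorem sum_cos_sq (θ : ℝ) (m : ℕ) :
    4 * Real.sin (2 * θ) * ∑ j ∈ Finset.range m, Real.cos ((2 * j + 1) * θ) ^ 2 =
      2 * m * Real.sin (2 * θ) + Real.sin (4 * m * θ) := by
  induction m with
  | zero => simp
  | succ m ih =>
    have h1 : Real.cos ((2 * m + 1) * θ) ^ 2 = 1 / 2 + Real.cos ((4 * m + 2) * θ) / 2 := by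
      rw [Real.cos_sq]
      ring_nf
    have h2 : Real.sin (4 * (m + 1 : ℕ) * θ) =
        Real.sin (4 * m * θ) + 2 * Real.sin (2 * θ) * Real.cos ((4 * m + 2) * θ) := by
      push_cast
      rw [show (4 * (m + 1) * θ : ℝ) = (4 * m + 2) * θ + 2 * θ by ring,
        show (4 * m * θ : ℝ) = (4 * m + 2) * θ - 2 * θ by ring, Real.sin_add, Real.sin_sub]
      ring
    rw [Finset.sum_range_succ, mul_add, ih, h1, h2]
    push_cast
    ring

/-- If `j` is uniform on an interval of length at least `√N`, then the search succeeds with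
probability at least `1 / 4`. -/
theorem sum_failProb_le (f : Cell d → Fin n) (C : Finset (Fin n)) (h : 0 < totalDeg d C)
    (hmark : 0 < markedCount f C) (m : ℕ) (hm : Real.sqrt (totalDeg d C) ≤ m) :
    ∑ j ∈ Finset.range m, failProb f C h j ≤ ENNReal.ofReal (3 / 4 * m) := by
  obtain ⟨θ, hs, hc⟩ := exists_angle f C h
  have h0 : (0 : ℝ) < totalDeg d C := by exact_mod_cast h
  have hN : 0 < Real.sqrt (totalDeg d C) := Real.sqrt_pos.2 h0
  have hNN : Real.sqrt (totalDeg d C) * Real.sqrt (totalDeg d C) = totalDeg d C :=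
    Real.mul_self_sqrt h0.le
  rw [Finset.sum_congr rfl fun j _ => failProb_eq f C h θ hs hc j,
    ← ENNReal.ofReal_sum_of_nonneg fun _ _ => sq_nonneg _]
  apply ENNReal.ofReal_le_ofReal
  rcases Nat.eq_zero_or_pos (unmarkedCount f C) with hu | hu
  -- If all cells of `C` are marked, the search cannot fail. This case is separate because sin 2θ
  -- vanishes.
  · have hz : ∀ j : ℕ, Real.cos ((2 * j + 1) * θ) = 0 := by
      intro j
      obtain ⟨a, b, -, -, hb⟩ := final_eq f C h θ hs hc j
      rw [← hb, hu]
      simp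
    simp only [hz]
    simp
  · have hsum : (markedCount f C : ℝ) + unmarkedCount f C = totalDeg d C := by
      exact_mod_cast markedCount_add_unmarkedCount f C
    have ht1 : (1 : ℝ) ≤ markedCount f C := by exact_mod_cast hmark
    have hu1 : (1 : ℝ) ≤ unmarkedCount f C := by exact_mod_cast hu
    -- With t marked and u unmarked cells, t, u ≥ 1 and t + u = N give N ≤ 4tu. As sin 2θ =
    -- 2√(tu)/N, this means 1 ≤ √N sin 2θ ≤ m sin 2θ, which absorbs the oscillating term of
    -- `sum_cos_sq`.
    have hle : Real.sqrt (totalDeg d C) ≤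
        2 * (Real.sqrt (markedCount f C) * Real.sqrt (unmarkedCount f C)) := by
      rw [← Real.sqrt_mul (Nat.cast_nonneg _), Real.sqrt_le_left (by positivity), mul_pow,
        Real.sq_sqrt (by positivity)]
      nlinarith
    have h1 : 1 ≤ Real.sqrt (totalDeg d C) * Real.sin (2 * θ) := by
      rw [hs, hc] at hle
      rw [Real.sin_two_mul]
      refine le_of_mul_le_mul_left ?_ hN
      linarith
    have hsin : 0 < Real.sin (2 * θ) := pos_of_mul_pos_right (one_pos.trans_le h1) hN.le
    have h2 : 1 ≤ m * Real.sin (2 * θ) := h1.trans (by gcongr)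
    have h3 := sum_cos_sq θ m
    have h4 := Real.sin_le_one (4 * m * θ)
    refine le_of_mul_le_mul_left ?_ (mul_pos four_pos hsin)
    linarith

end Grover

/-! ### Components and added edges -/

section Components

variable {n : ℕ}

theorem mem_component {A : Finset (Sym2 (Fin n))} {u v : Fin n} :
    v ∈ component A u ↔ (edgeGraph A).Reachable u v := by
  simp [component]

theorem self_mem_component (A : Finset (Sym2 (Fin n))) (u : Fin n) : u ∈ component A u :=
  mem_component.2 .rfl

theorem component_card_pos (A : Finset (Sym2 (Fin n))) (u : Fin n) : 0 < (component A u).card :=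
  Finset.card_pos.2 ⟨u, self_mem_component A u⟩

theorem component_eq_of_mem {A : Finset (Sym2 (Fin n))} {u v : Fin n} (h : v ∈ component A u) :
    component A v = component A u := by
  have h := mem_component.1 h
  ext w
  simp only [mem_component]
  exact ⟨h.trans, h.symm.trans⟩

theorem disjoint_component {A : Finset (Sym2 (Fin n))} {u v : Fin n} (h : v ∉ component A u) :
    Disjoint (component A u) (component A v) := by
  rw [Finset.disjoint_left]
  intro w hu hv
  apply h
  rw [← component_eq_of_mem hu, component_eq_of_mem hv]
  exact self_mem_component A v

theorem edgeGraph_insert (A : Finset (Sym2 (Fin n))) (a b : Fin n) :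
    edgeGraph (insert s(a, b) A) = edgeGraph A ⊔ SimpleGraph.edge a b := by
  rw [edgeGraph, Finset.coe_insert, Set.insert_eq, Set.union_comm, SimpleGraph.edge, edgeGraph,
    SimpleGraph.fromEdgeSet_union]

theorem edgeGraph_mono {A B : Finset (Sym2 (Fin n))} (h : A ⊆ B) : edgeGraph A ≤ edgeGraph B :=
  SimpleGraph.fromEdgeSet_mono (by exact_mod_cast h)

theorem isAcyclic_insert {A : Finset (Sym2 (Fin n))} {a b : Fin n}
    (hA : (edgeGraph A).IsAcyclic) (h : b ∉ component A a) :
    (edgeGraph (insert s(a, b) A)).IsAcyclic := by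
  rw [edgeGraph_insert]
  exact hA.sup_edge_of_not_reachable fun hr => h (mem_component.2 hr)

/-- A set closed under the edges of `A` contains the whole component of each of its vertices. The
components after an insertion are computed by exhibiting closed sets. -/
theorem mem_of_reachable {A : Finset (Sym2 (Fin n))} {X : Finset (Fin n)}
    (h : ∀ x y, s(x, y) ∈ A → x ∈ X → y ∈ X) {u v : Fin n} (hu : u ∈ X)
    (huv : (edgeGraph A).Reachable u v) : v ∈ X := by
  obtain ⟨p⟩ := huv
  induction p with
  | nil => exact hu
  | cons hadj p ih =>
    refine ih (h _ _ ?_ hu)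
    simpa using ((SimpleGraph.fromEdgeSet_adj _).1 hadj).1

theorem component_subset {A : Finset (Sym2 (Fin n))} {X : Finset (Fin n)}
    (h : ∀ x y, s(x, y) ∈ A → x ∈ X → y ∈ X) {u : Fin n} (hu : u ∈ X) :
    component A u ⊆ X :=
  fun _ hv => mem_of_reachable h hu (mem_component.1 hv)

theorem component_mono {A B : Finset (Sym2 (Fin n))} (h : A ⊆ B) (u : Fin n) :
    component A u ⊆ component B u := fun _ hv =>
  mem_component.2 ((mem_component.1 hv).mono (edgeGraph_mono h))

theorem mem_component_of_mem {A : Finset (Sym2 (Fin n))} {u x y : Fin n} (h : s(x, y) ∈ A)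
    (hx : x ∈ component A u) : y ∈ component A u := by
  by_cases hxy : x = y
  · exact hxy ▸ hx
  · refine mem_component.2 ((mem_component.1 hx).trans (SimpleGraph.Adj.reachable ?_))
    exact (SimpleGraph.fromEdgeSet_adj _).2 ⟨by exact_mod_cast h, hxy⟩

theorem component_insert_left (A : Finset (Sym2 (Fin n))) (a b : Fin n) :
    component (insert s(a, b) A) a = component A a ∪ component A b := by
  have hb : b ∈ component (insert s(a, b) A) a :=
    mem_component_of_mem (Finset.mem_insert_self _ _) (self_mem_component _ _)
  apply subset_antisymm
  · refine component_subset (fun x y hxy hx => ?_)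
      (Finset.mem_union_left _ (self_mem_component A a))
    rcases Finset.mem_insert.1 hxy with h | h
    · rcases Sym2.eq_iff.1 h with ⟨-, rfl⟩ | ⟨-, rfl⟩
      · exact Finset.mem_union_right _ (self_mem_component _ _)
      · exact Finset.mem_union_left _ (self_mem_component _ _)
    · rcases Finset.mem_union.1 hx with hx | hx
      · exact Finset.mem_union_left _ (mem_component_of_mem h hx)
      · exact Finset.mem_union_right _ (mem_component_of_mem h hx)
  · refine Finset.union_subset (component_mono (Finset.subset_insert _ _) a) ?_
    rw [← component_eq_of_mem hb]
    exact component_mono (Finset.subset_insert _ _) b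

theorem component_insert_of_mem {A : Finset (Sym2 (Fin n))} {a b u : Fin n}
    (h : u ∈ component A a ∪ component A b) :
    component (insert s(a, b) A) u = component A a ∪ component A b := by
  rw [← component_insert_left] at h ⊢
  exact component_eq_of_mem h

theorem component_insert_of_notMem {A : Finset (Sym2 (Fin n))} {a b u : Fin n}
    (ha : a ∉ component A u) (hb : b ∉ component A u) :
    component (insert s(a, b) A) u = component A u := by
  apply subset_antisymm
  · refine component_subset (fun x y hxy hx => ?_) (self_mem_component A u)
    rcases Finset.mem_insert.1 hxy with h | h
    · rcases Sym2.eq_iff.1 h with ⟨rfl, rfl⟩ | ⟨rfl, rfl⟩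
      · exact absurd hx ha
      · exact absurd hx hb
    · exact mem_component_of_mem h hx
  · exact component_mono (Finset.subset_insert _ _) u

theorem mem_component_comm {A : Finset (Sym2 (Fin n))} {u v : Fin n} :
    u ∈ component A v ↔ v ∈ component A u := by
  simp only [mem_component]
  exact SimpleGraph.reachable_comm

theorem component_eq_singleton {A : Finset (Sym2 (Fin n))} {u : Fin n}
    (h : ∀ e ∈ A, u ∉ e) : component A u = {u} := by
  refine subset_antisymm (component_subset (fun x y hxy hx => ?_) (by simp))
    (by simpa using self_mem_component A u)
  rw [Finset.mem_singleton] at hx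
  exact absurd (hx ▸ Sym2.mem_mk_left x y) (h _ hxy)

theorem totalDeg_union {d : Fin n → ℕ} {C D : Finset (Fin n)} (h : Disjoint C D) :
    totalDeg d (C ∪ D) = totalDeg d C + totalDeg d D :=
  Finset.sum_union h

theorem totalDeg_le {d : Fin n → ℕ} {C : Finset (Fin n)} {m : ℕ} (h : ∀ u ∈ C, d u ≤ m) :
    totalDeg d C ≤ C.card * m :=
  Finset.sum_le_card_nsmul C d m h

end Components

/-! ### The preprocessing -/

namespace Connectivity

variable {n : ℕ}

/-- The edges selected form a forest in `G`. -/
structure Forest (G : AdjArray n) (A : Finset (Sym2 (Fin n))) : Prop where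
  subset : (A : Set (Sym2 (Fin n))) ⊆ G.graph.edgeSet
  acyclic : (edgeGraph A).IsAcyclic

theorem Forest.insert {G : AdjArray n} {A : Finset (Sym2 (Fin n))} (h : Forest G A)
    (x : Cell G.deg) (hx : G.oracle x ∉ component A x.1) :
    Forest G (insert s(x.1, G.oracle x) A) where
  subset := by
    rw [Finset.coe_insert, Set.insert_subset_iff]
    exact ⟨⟨x.2, rfl⟩, h.subset⟩
  acyclic := isAcyclic_insert h.acyclic hx

theorem Forest.isSpanningTree {G : AdjArray n} {B : Finset (Sym2 (Fin n))} (h : Forest G B)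
    (hB : (edgeGraph B).Connected) : IsSpanningTree G.graph B :=
  ⟨h.subset, ⟨hB, h.acyclic⟩⟩

/-- The vertices outside `S` are in components of small total degree, which have more vertices than
the degrees of the vertices in `S`. -/
structure Placed (d : Fin n → ℕ) (S : Finset (Fin n)) (A : Finset (Sym2 (Fin n))) : Prop where
  totalDeg_le : ∀ u ∉ S, totalDeg d (component A u) ≤ (component A u).card ^ 2
  deg_lt : ∀ u ∉ S, ∀ w ∈ S, d w < (component A u).card

/-- The invariant at the beginning of a phase of the preprocessing. -/
structure PlaceInv (G : AdjArray n) (S : Finset (Fin n)) (A : Finset (Sym2 (Fin n))) : Prop where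
  forest : Forest G A
  placed : Placed G.deg S A
  isolated : ∀ e ∈ A, ∀ u ∈ e, u ∉ S

/-- The invariant while the neighbours of `v` are read. -/
structure ScanInv (G : AdjArray n) (S : Finset (Fin n)) (A : Finset (Sym2 (Fin n))) (v : Fin n)
    (D : Finset (Fin n)) (j : ℕ) : Prop where
  forest : Forest G A
  placed : Placed G.deg S A
  isolated : ∀ e ∈ A, ∀ u ∈ e, u ∈ S → u ∈ D
  max : ∀ w ∈ S, G.deg w ≤ G.deg v
  component_eq : component A v = D
  subset : D ⊆ S
  card_eq : D.card = j + 1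
  read : ∀ w ∈ D, w = v ∨ ∃ i : Fin (G.deg v), i < j ∧ G.nbr v i = w

theorem placeInv_start (G : AdjArray n) : PlaceInv G Finset.univ ∅ where
  forest := ⟨by simp, by simp [edgeGraph]⟩
  placed := ⟨by simp, by simp⟩
  isolated := by simp

theorem PlaceInv.scanInv {G : AdjArray n} {S : Finset (Fin n)} {A : Finset (Sym2 (Fin n))}
    (h : PlaceInv G S A) {v : Fin n} (hv : v ∈ S) (hmax : ∀ w ∈ S, G.deg w ≤ G.deg v) :
    ScanInv G S A v {v} 0 where
  forest := h.forest
  placed := h.placed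
  isolated e he u hu hS := absurd hS (h.isolated e he u hu)
  max := hmax
  component_eq := component_eq_singleton fun e he hu => h.isolated e he v hu hv
  subset := by simpa using hv
  card_eq := by simp
  read := by simp

variable {G : AdjArray n} {S : Finset (Fin n)} {A : Finset (Sym2 (Fin n))} {v : Fin n}
  {D : Finset (Fin n)} {j : ℕ}

theorem ScanInv.mem (h : ScanInv G S A v D j) : v ∈ D :=
  h.component_eq ▸ self_mem_component A v

/-- The array of `v` has no repetitions and does not contain `v`, so each query reads a vertex that
is not yet in `D`. This keeps |D| one more than the number of queries of the phase. -/
theorem ScanInv.nbr_notMem (h : ScanInv G S A v D j) (hj : j < G.deg v) :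
    G.nbr v ⟨j, hj⟩ ∉ D := by
  intro hw
  rcases h.read _ hw with hv | ⟨i, hi, hiw⟩
  · exact G.nbr_ne _ _ hv
  · have := G.nbr_injective v hiw
    simp [this] at hi

/-- The complement of `S` is closed under the edges of `A`: an edge leading into `S` would end in
`D`, the component of `v`, and would then also begin in `D ⊆ S`. -/
theorem ScanInv.component_disjoint (h : ScanInv G S A v D j) {u : Fin n} (hu : u ∉ S) :
    Disjoint (component A u) S := by
  have hX : ∀ x y, s(x, y) ∈ A → x ∈ Finset.univ \ S → y ∈ Finset.univ \ S := by
    intro x y hxy hx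
    simp only [Finset.mem_sdiff, Finset.mem_univ, true_and] at hx ⊢
    intro hy
    have hyD := h.isolated _ hxy y (Sym2.mem_mk_right x y) hy
    rw [← h.component_eq] at hyD
    have hxD := mem_component_of_mem (Sym2.eq_swap (a := x) ▸ hxy) hyD
    exact hx (h.subset (h.component_eq ▸ hxD))
  refine Finset.disjoint_of_subset_left (component_subset hX (by simpa using hu)) ?_
  exact Finset.sdiff_disjoint

theorem ScanInv.totalDeg_le (h : ScanInv G S A v D j) :
    totalDeg G.deg D ≤ D.card * G.deg v :=
  _root_.totalDeg_le fun u hu => h.max u (h.subset hu)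

theorem ScanInv.card_sdiff (h : ScanInv G S A v D j) : (S \ D).card + (j + 1) = S.card := by
  rw [← h.card_eq, Finset.card_sdiff_add_card_eq_card h.subset]

theorem ScanInv.step (h : ScanInv G S A v D j) (hj : j < G.deg v)
    (hw : G.nbr v ⟨j, hj⟩ ∈ S) :
    ScanInv G S (insert s(v, G.nbr v ⟨j, hj⟩) A) v (insert (G.nbr v ⟨j, hj⟩) D) (j + 1) := by
  have hwD := h.nbr_notMem hj
  have hcomp : component A (G.nbr v ⟨j, hj⟩) = {G.nbr v ⟨j, hj⟩} :=
    component_eq_singleton fun e he hu => hwD (h.isolated e he _ hu hw)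
  have hold : ∀ u ∉ S, component (insert s(v, G.nbr v ⟨j, hj⟩) A) u = component A u := by
    intro u hu
    have hd := Finset.disjoint_right.1 (h.component_disjoint hu)
    exact component_insert_of_notMem (hd (h.subset h.mem)) (hd hw)
  refine ⟨?_, ⟨?_, ?_⟩, ?_, h.max, ?_, ?_, ?_, ?_⟩
  · exact h.forest.insert ⟨v, j, hj⟩ (by rw [h.component_eq]; exact hwD)
  · intro u hu
    rw [hold u hu]
    exact h.placed.totalDeg_le u hu
  · intro u hu
    rw [hold u hu]
    exact h.placed.deg_lt u hu
  · intro e he u hu huS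
    rcases Finset.mem_insert.1 he with rfl | he
    · rcases Sym2.mem_iff.1 hu with rfl | rfl
      · exact Finset.mem_insert_of_mem h.mem
      · exact Finset.mem_insert_self _ _
    · exact Finset.mem_insert_of_mem (h.isolated e he u hu huS)
  · rw [component_insert_left, h.component_eq, hcomp, Finset.union_comm]
    rfl
  · exact Finset.insert_subset hw h.subset
  · rw [Finset.card_insert_of_notMem hwD, h.card_eq]
  · intro w hw
    rcases Finset.mem_insert.1 hw with rfl | hw
    · exact Or.inr ⟨⟨j, hj⟩, Nat.lt_succ_self j, rfl⟩
    · exact (h.read w hw).imp id fun ⟨i, hi, hiw⟩ => ⟨i, Nat.lt_succ_of_lt hi, hiw⟩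

theorem ScanInv.merge (h : ScanInv G S A v D j) (hj : j < G.deg v)
    (hw : G.nbr v ⟨j, hj⟩ ∉ S) :
    PlaceInv G (S \ D) (insert s(v, G.nbr v ⟨j, hj⟩) A) := by
  set w := G.nbr v ⟨j, hj⟩ with hwdef
  have hdisj := h.component_disjoint hw
  have hDw : Disjoint D (component A w) := (Finset.disjoint_of_subset_right h.subset hdisj).symm
  have hlt := h.placed.deg_lt w hw
  have hsq := h.placed.totalDeg_le w hw
  have hcases : ∀ u ∉ S \ D, component (insert s(v, w) A) u = D ∪ component A w ∨
      (u ∉ S ∧ component (insert s(v, w) A) u = component A u) := by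
    intro u hu
    rw [← h.component_eq]
    by_cases huw : u ∈ component A v ∪ component A w
    · exact Or.inl (component_insert_of_mem huw)
    · rw [Finset.mem_union, not_or, mem_component_comm, mem_component_comm (v := w)] at huw
      refine Or.inr ⟨fun huS => ?_, component_insert_of_notMem huw.1 huw.2⟩
      rw [mem_component_comm, h.component_eq] at huw
      exact hu (Finset.mem_sdiff.2 ⟨huS, huw.1⟩)
  have hcard : (D ∪ component A w).card = D.card + (component A w).card :=
    Finset.card_union_of_disjoint hDw
  refine ⟨?_, ⟨?_, ?_⟩, ?_⟩
  · exact h.forest.insert ⟨v, j, hj⟩ (by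
      rw [h.component_eq]
      exact fun hD => hw (h.subset hD))
  · intro u hu
    rcases hcases u hu with hc | ⟨huS, hc⟩
    · rw [hc, totalDeg_union hDw, hcard]
      have h1 := h.totalDeg_le
      have h2 : G.deg v < (component A w).card := hlt v (h.subset h.mem)
      -- With K the component of `w`: m_D + m_K ≤ |D| deg v + |K|² ≤ |D||K| + |K|² ≤ (|D| + |K|)².
      nlinarith
    · rw [hc]
      exact h.placed.totalDeg_le u huS
  · intro u hu x hx
    have hxS := (Finset.mem_sdiff.1 hx).1
    rcases hcases u hu with hc | ⟨huS, hc⟩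
    · rw [hc, hcard]
      exact (hlt x hxS).trans_le (Nat.le_add_left _ _)
    · rw [hc]
      exact h.placed.deg_lt u huS x hxS
  · intro e he u hu huS
    rw [Finset.mem_sdiff] at huS
    rcases Finset.mem_insert.1 he with rfl | he
    · rcases Sym2.mem_iff.1 hu with rfl | rfl
      · exact huS.2 h.mem
      · exact hw huS.1
    · exact huS.2 (h.isolated e he u hu huS.1)

/-- When the list is exhausted, `D` has more vertices than deg v. Since `v` has maximal degree in
`S`, this bounds the total degree of `D` and also makes |D| exceed every degree left. -/
theorem ScanInv.finish (h : ScanInv G S A v D j) (hj : ¬ j < G.deg v) : PlaceInv G (S \ D) A := by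
  have hcard : G.deg v < D.card := by
    rw [h.card_eq]
    omega
  have hcases : ∀ u ∉ S \ D, component A u = D ∨ u ∉ S := by
    intro u hu
    by_cases huS : u ∈ S
    · have huD : u ∈ D := by simpa [huS] using hu
      rw [← h.component_eq] at huD ⊢
      exact Or.inl (component_eq_of_mem huD)
    · exact Or.inr huS
  refine ⟨h.forest, ⟨?_, ?_⟩, ?_⟩
  · intro u hu
    rcases hcases u hu with hc | huS
    · rw [hc, sq]
      exact h.totalDeg_le.trans (Nat.mul_le_mul_left _ hcard.le)
    · exact h.placed.totalDeg_le u huS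
  · intro u hu x hx
    have hxS := (Finset.mem_sdiff.1 hx).1
    rcases hcases u hu with hc | huS
    · rw [hc]
      exact (h.max x hxS).trans_lt hcard
    · exact h.placed.deg_lt u huS x hxS
  · intro e he u hu huS
    rw [Finset.mem_sdiff] at huS
    exact huS.2 (h.isolated e he u hu huS.1)

/-! ### The invariant of the run, the one-step laws and the outputs. -/

/-- The invariant of the whole run. -/
def Inv [NeZero n] (G : AdjArray n) : CState G.deg → Prop
  | .place S A => PlaceInv G S A
  | .scan S A v D j => ScanInv G S A v D j
  | .loop A => Forest G A
  | .search A C _ => Forest G A ∧ ¬ (edgeGraph A).Connected ∧ C = lightestComponent G.deg A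
  | .grover A C _ _ => Forest G A ∧ ¬ (edgeGraph A).Connected ∧ C = lightestComponent G.deg A
  | .check A C _ x => Forest G A ∧ ¬ (edgeGraph A).Connected ∧ C = lightestComponent G.deg A ∧
      x.1 ∈ C

theorem highestDegree_mem (d : Fin n → ℕ) (S : Finset (Fin n)) (h : S.Nonempty) :
    highestDegree d S h ∈ S :=
  (S.exists_max_image d h).choose_spec.1

theorem le_highestDegree (d : Fin n → ℕ) (S : Finset (Fin n)) (h : S.Nonempty) :
    ∀ w ∈ S, d w ≤ d (highestDegree d S h) :=
  (S.exists_max_image d h).choose_spec.2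

variable [NeZero n]

theorem lightestComponent_eq (d : Fin n → ℕ) (A : Finset (Sym2 (Fin n))) {u : Fin n}
    (hu : u ∈ lightestComponent d A) : component A u = lightestComponent d A :=
  component_eq_of_mem hu

theorem totalDeg_lightestComponent_le (d : Fin n → ℕ) (A : Finset (Sym2 (Fin n))) (u : Fin n) :
    totalDeg d (lightestComponent d A) ≤ totalDeg d (component A u) :=
  Function.argmin_le (fun u => totalDeg d (component A u)) u

/-- The distribution of the control state after one step. -/
noncomputable def nextLaw (G : AdjArray n) (c : CState G.deg) : PMF (CState G.deg) :=
  (connectivityAlgorithm G.deg).next G.oracle c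

theorem next_place_of_nonempty (hS : S.Nonempty) :
    nextLaw G (.place S A) =
      PMF.pure (.scan S A (highestDegree G.deg S hS) {highestDegree G.deg S hS} 0) := by
  simp [nextLaw, QAlgorithm.next, connectivityAlgorithm, connectivityAction, hS]

theorem next_place_of_empty (hS : ¬ S.Nonempty) :
    nextLaw G (.place S A) = PMF.pure (.loop A) := by
  simp [nextLaw, QAlgorithm.next, connectivityAlgorithm, connectivityAction, hS]

theorem next_scan_of_mem (hj : j < G.deg v) (hw : G.nbr v ⟨j, hj⟩ ∈ S) :
    nextLaw G (.scan S A v D j) =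
      PMF.pure (.scan S (insert s(v, G.nbr v ⟨j, hj⟩) A) v
        (insert (G.nbr v ⟨j, hj⟩) D) (j + 1)) := by
  simp [nextLaw, QAlgorithm.next, connectivityAlgorithm, connectivityAction, hj, AdjArray.oracle, hw]

theorem next_scan_of_notMem (hj : j < G.deg v) (hw : G.nbr v ⟨j, hj⟩ ∉ S) :
    nextLaw G (.scan S A v D j) =
      PMF.pure (.place (S \ D) (insert s(v, G.nbr v ⟨j, hj⟩) A)) := by
  simp [nextLaw, QAlgorithm.next, connectivityAlgorithm, connectivityAction, hj, AdjArray.oracle, hw]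

theorem next_scan_of_not_lt (hj : ¬ j < G.deg v) :
    nextLaw G (.scan S A v D j) =
      PMF.pure (.place (S \ D) A) := by
  simp [nextLaw, QAlgorithm.next, connectivityAlgorithm, connectivityAction, hj]

theorem next_loop_of_connected (hA : (edgeGraph A).Connected) :
    nextLaw G (.loop A) = PMF.pure (.loop A) := by
  simp [nextLaw, QAlgorithm.next, connectivityAlgorithm, connectivityAction, hA]

theorem next_loop_of_not_connected (hA : ¬ (edgeGraph A).Connected) :
    nextLaw G (.loop A) =
      PMF.pure (.search A (lightestComponent G.deg A) 0) := by
  simp [nextLaw, QAlgorithm.next, connectivityAlgorithm, connectivityAction, hA]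

variable {C : Finset (Fin n)} {r : ℕ}

theorem next_search_of_pos (hC : 0 < totalDeg G.deg C) :
    nextLaw G (.search A C r) =
      (PMF.uniformOfFinset _ (range_roundBound_nonempty hC r)).map fun j => .grover A C r j := by
  simp [nextLaw, QAlgorithm.next, connectivityAlgorithm, connectivityAction, hC]

theorem next_search_of_not_pos (hC : ¬ 0 < totalDeg G.deg C) :
    nextLaw G (.search A C r) = PMF.pure (.search A C r) := by
  simp [nextLaw, QAlgorithm.next, connectivityAlgorithm, connectivityAction, hC]

theorem next_grover_of_pos (hC : 0 < totalDeg G.deg C) :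
    nextLaw G (.grover A C r j) =
      ((groverCircuit G.deg C hC j).outcome G.oracle).map fun z => .check A C r z.1 := by
  simp [nextLaw, QAlgorithm.next, connectivityAlgorithm, connectivityAction, hC]

theorem next_grover_of_not_pos (hC : ¬ 0 < totalDeg G.deg C) :
    nextLaw G (.grover A C r j) =
      PMF.pure (.search A C r) := by
  simp [nextLaw, QAlgorithm.next, connectivityAlgorithm, connectivityAction, hC]

theorem next_check_of_mem {x : Cell G.deg} (hx : G.oracle x ∈ C) :
    nextLaw G (.check A C r x) =
      PMF.pure (.search A C (r + 1)) := by
  simp [nextLaw, QAlgorithm.next, connectivityAlgorithm, connectivityAction, hx]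

theorem next_check_of_notMem {x : Cell G.deg} (hx : G.oracle x ∉ C) :
    nextLaw G (.check A C r x) =
      PMF.pure (.loop (insert s(x.1, G.oracle x) A)) := by
  simp [nextLaw, QAlgorithm.next, connectivityAlgorithm, connectivityAction, hx]

theorem inv_next (c : CState G.deg) (hc : Inv G c) :
    ∀ c' ∈ (nextLaw G c).support, Inv G c' := by
  have pure_case : ∀ c₁ : CState G.deg,
      nextLaw G c = PMF.pure c₁ → Inv G c₁ →
      ∀ c' ∈ (nextLaw G c).support, Inv G c' := by
    intro c₁ h h₁ c' hc'
    rw [h, PMF.support_pure] at hc'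
    exact hc' ▸ h₁
  cases c with
  | place S A =>
    by_cases hS : S.Nonempty
    · exact pure_case _ (next_place_of_nonempty hS)
        (PlaceInv.scanInv hc (highestDegree_mem _ _ _) (le_highestDegree _ _ _))
    · exact pure_case _ (next_place_of_empty hS) hc.forest
  | scan S A v D j =>
    by_cases hj : j < G.deg v
    · by_cases hw : G.nbr v ⟨j, hj⟩ ∈ S
      · exact pure_case _ (next_scan_of_mem hj hw) (ScanInv.step hc hj hw)
      · exact pure_case _ (next_scan_of_notMem hj hw) (ScanInv.merge hc hj hw)
    · exact pure_case _ (next_scan_of_not_lt hj) (ScanInv.finish hc hj)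
  | loop A =>
    by_cases hA : (edgeGraph A).Connected
    · exact pure_case _ (next_loop_of_connected hA) hc
    · exact pure_case _ (next_loop_of_not_connected hA) ⟨hc, hA, rfl⟩
  | search A C r =>
    by_cases hC : 0 < totalDeg G.deg C
    · rw [next_search_of_pos hC]
      intro c' hc'
      rw [PMF.support_map] at hc'
      obtain ⟨j, -, rfl⟩ := hc'
      exact hc
    · exact pure_case _ (next_search_of_not_pos hC) hc
  | grover A C r j =>
    by_cases hC : 0 < totalDeg G.deg C
    · rw [next_grover_of_pos hC]
      intro c' hc'
      rw [PMF.support_map] at hc'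
      obtain ⟨z, hz, rfl⟩ := hc'
      exact ⟨hc.1, hc.2.1, hc.2.2, Grover.outcome_support _ _ hC j z hz⟩
    · exact pure_case _ (next_grover_of_not_pos hC) hc
  | check A C r x =>
    obtain ⟨hF, hA, rfl, hx⟩ := hc
    by_cases hw : G.oracle x ∈ lightestComponent G.deg A
    · exact pure_case _ (next_check_of_mem hw) ⟨hF, hA, rfl⟩
    · refine pure_case _ (next_check_of_notMem hw) (hF.insert x ?_)
      rwa [lightestComponent_eq _ _ hx]

theorem inv_start : Inv G (connectivityAlgorithm G.deg).start := placeInv_start G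

theorem inv_halt (c : CState G.deg) (hc : Inv G c) (B : Finset (Sym2 (Fin n)))
    (hB : connectivityAction G.deg c = .halt B) : Forest G B ∧ (edgeGraph B).Connected := by
  cases c with
  | place S A => by_cases hS : S.Nonempty <;> simp [connectivityAction, hS] at hB
  | scan S A v D j => by_cases hj : j < G.deg v <;> simp [connectivityAction, hj] at hB
  | loop A =>
    by_cases hA : (edgeGraph A).Connected
    · simp only [connectivityAction, hA, if_true, QAction.halt.injEq] at hB
      exact hB ▸ ⟨hc, hA⟩
    · simp [connectivityAction, hA] at hB
  | search A C r => by_cases hC : 0 < totalDeg G.deg C <;> simp [connectivityAction, hC] at hB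
  | grover A C r j => by_cases hC : 0 < totalDeg G.deg C <;> simp [connectivityAction, hC] at hB
  | check A C r x => simp [connectivityAction] at hB

/-- A reachable halting state carries a connected edge set contained in the graph, which would make
the graph connected. -/
theorem haltProb_eq_zero (hG : ¬ G.graph.Connected) (t : ℕ) :
    (connectivityAlgorithm G.deg).haltProb G.oracle Set.univ t = 0 := by
  rw [QAlgorithm.haltProb, PMF.toOuterMeasure_apply_eq_zero_iff, Set.disjoint_left]
  rintro c hc ⟨B, -, hB⟩
  obtain ⟨hF, hconn⟩ := inv_halt c
    (QAlgorithm.law_invariant _ _ (Inv G) inv_start inv_next t c hc) B hB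
  refine hG (hconn.mono ?_)
  rw [← SimpleGraph.fromEdgeSet_edgeSet G.graph]
  exact SimpleGraph.fromEdgeSet_mono hF.subset

/-! ### The deterministic run of the preprocessing. -/

/-- The number of queries that the preprocessing can still make. -/
def queriesLeft {d : Fin n → ℕ} : CState d → ℕ
  | .place S _ => S.card
  | .scan S _ _ _ j => S.card - j
  | _ => 0

/-- The number of steps that the preprocessing can still make. -/
def stepsLeft {d : Fin n → ℕ} : CState d → ℕ
  | .place S _ => 3 * S.card + 1
  | .scan S _ _ _ j => 3 * S.card - 2 * j
  | _ => 0

/-- The run that is in state `law s` after `s` steps reaches the main loop with certainty, by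
classical steps with at most `q` queries. -/
def ReachesLoop (G : AdjArray n) (s q : ℕ) : Prop :=
  ∃ (t : ℕ) (A : Finset (Sym2 (Fin n))), s ≤ t ∧
    (connectivityAlgorithm G.deg).law G.oracle t = PMF.pure (CState.loop A) ∧
    (∀ i, s ≤ i → i < t → ∀ x ∈ ((connectivityAlgorithm G.deg).law G.oracle i).support,
      (connectivityAlgorithm G.deg).ClassicalAt x) ∧
    ∑ i ∈ Finset.Ico s t, (connectivityAlgorithm G.deg).stepQueries G.oracle i ≤ q ∧
    PlaceInv G ∅ A

theorem law_succ_of_pure {s : ℕ} {c c' : CState G.deg}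
    (hs : (connectivityAlgorithm G.deg).law G.oracle s = PMF.pure c)
    (hc : nextLaw G c = PMF.pure c') :
    (connectivityAlgorithm G.deg).law G.oracle (s + 1) = PMF.pure c' := by
  rw [QAlgorithm.law, hs]
  exact (PMF.pure_bind _ _).trans hc

theorem ReachesLoop.of_next {s q q' : ℕ} {c : CState G.deg}
    (hs : (connectivityAlgorithm G.deg).law G.oracle s = PMF.pure c)
    (hcl : (connectivityAlgorithm G.deg).ClassicalAt c)
    (hq : (connectivityAlgorithm G.deg).queries c + q' ≤ q) (h : ReachesLoop G (s + 1) q') :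
    ReachesLoop G s q := by
  obtain ⟨t, A, hst, hlaw, hclass, hsum, hA⟩ := h
  refine ⟨t, A, by omega, hlaw, fun i hi hit x hx => ?_, ?_, hA⟩
  · rcases hi.eq_or_lt with rfl | hi
    · rw [hs] at hx
      exact (PMF.mem_support_pure_iff _ _).1 hx ▸ hcl
    · exact hclass i hi hit x hx
  · rw [Finset.sum_eq_sum_Ico_succ_bot (by omega)]
    have h0 : (connectivityAlgorithm G.deg).stepQueries G.oracle s =
        (connectivityAlgorithm G.deg).queries c := by
      rw [QAlgorithm.stepQueries, hs]
      exact PMF.expect_pure c fun c => ((connectivityAlgorithm G.deg).queries c : ℝ≥0∞)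
    rw [h0]
    calc _ ≤ ((connectivityAlgorithm G.deg).queries c : ℝ≥0∞) + q' := by gcongr
      _ ≤ q := by exact_mod_cast hq

theorem queries_place : (connectivityAlgorithm G.deg).queries (.place S A) = 0 := by
  by_cases hS : S.Nonempty <;>
    simp [QAlgorithm.queries, connectivityAlgorithm, connectivityAction, hS]

theorem queries_scan_of_lt (hj : j < G.deg v) :
    (connectivityAlgorithm G.deg).queries (.scan S A v D j) = 1 := by
  simp [QAlgorithm.queries, connectivityAlgorithm, connectivityAction, hj]

theorem queries_scan_of_not_lt (hj : ¬ j < G.deg v) :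
    (connectivityAlgorithm G.deg).queries (.scan S A v D j) = 0 := by
  simp [QAlgorithm.queries, connectivityAlgorithm, connectivityAction, hj]

theorem classicalAt_place : (connectivityAlgorithm G.deg).ClassicalAt (.place S A) := by
  by_cases hS : S.Nonempty <;>
    simp [QAlgorithm.ClassicalAt, connectivityAlgorithm, connectivityAction, hS]

theorem classicalAt_scan : (connectivityAlgorithm G.deg).ClassicalAt (.scan S A v D j) := by
  by_cases hj : j < G.deg v <;>
    simp [QAlgorithm.ClassicalAt, connectivityAlgorithm, connectivityAction, hj]

/-- The preprocessing from a control state `c` that is reached with certainty. -/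
theorem reachesLoop (m : ℕ) : ∀ (s : ℕ) (c : CState G.deg), stepsLeft c ≤ m → Inv G c →
    -- Positivity singles out the preprocessing states, since `stepsLeft` is 0 on all others.
    0 < stepsLeft c → (connectivityAlgorithm G.deg).law G.oracle s = PMF.pure c →
    ReachesLoop G s (queriesLeft c) := by
  induction m with
  | zero =>
    intro s c hm _ hpos
    omega
  | succ m ih =>
    intro s c hm hc hpos hs
    have advance : ∀ c' : CState G.deg, nextLaw G c = PMF.pure c' → Inv G c' →
        (connectivityAlgorithm G.deg).ClassicalAt c →
        (connectivityAlgorithm G.deg).queries c + queriesLeft c' ≤ queriesLeft c →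
        stepsLeft c' < stepsLeft c → 0 < stepsLeft c' → ReachesLoop G s (queriesLeft c) :=
      fun c' hn hi hcl hq hlt hp =>
        ReachesLoop.of_next hs hcl hq (ih _ c' (by omega) hi hp (law_succ_of_pure hs hn))
    cases c with
    | place S A =>
      by_cases hS : S.Nonempty
      · refine advance _ (next_place_of_nonempty hS)
          (PlaceInv.scanInv hc (highestDegree_mem _ _ _) (le_highestDegree _ _ _))
          classicalAt_place ?_ ?_ ?_
        · rw [queries_place]
          simp [queriesLeft]
        · simp [stepsLeft]
        · simpa [stepsLeft] using hS
      · refine ReachesLoop.of_next (q' := 0) hs classicalAt_place ?_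
          ⟨s + 1, A, le_rfl, law_succ_of_pure hs (next_place_of_empty hS), ?_, ?_, ?_⟩
        · rw [queries_place]
          simp
        · intro i hi hit
          omega
        · simp
        · rw [← Finset.not_nonempty_iff_eq_empty.1 hS]
          exact hc
    | scan S A v D j =>
      -- This also gives j < |S|, so the natural subtractions in `queriesLeft` and `stepsLeft` do
      -- not truncate.
      have hcard := ScanInv.card_sdiff hc
      by_cases hj : j < G.deg v
      · by_cases hw : G.nbr v ⟨j, hj⟩ ∈ S
        · have hcard' := (ScanInv.step hc hj hw).card_sdiff
          refine advance _ (next_scan_of_mem hj hw) (ScanInv.step hc hj hw) classicalAt_scan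
            ?_ ?_ ?_
          · rw [queries_scan_of_lt hj]
            simp only [queriesLeft]
            omega
          · simp only [stepsLeft]
            omega
          · simp only [stepsLeft]
            omega
        · refine advance _ (next_scan_of_notMem hj hw) (ScanInv.merge hc hj hw) classicalAt_scan
            ?_ ?_ ?_
          · rw [queries_scan_of_lt hj]
            simp only [queriesLeft]
            omega
          · simp only [stepsLeft]
            omega
          · simp [stepsLeft]
      · refine advance _ (next_scan_of_not_lt hj) (ScanInv.finish hc hj) classicalAt_scan ?_ ?_ ?_
        · rw [queries_scan_of_not_lt hj]
          simp only [queriesLeft]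
          omega
        · simp only [stepsLeft]
          omega
        · simp [stepsLeft]
    | _ => simp [stepsLeft] at hpos

end Connectivity

/-! ### The expected number of queries -/

namespace Connectivity

section Potential

variable {n : ℕ}

/-- The sum of `√m_C` over the components `C` of `A`, as a sum over the vertices. -/
noncomputable def potential (d : Fin n → ℕ) (A : Finset (Sym2 (Fin n))) : ℝ :=
  ∑ u, Real.sqrt (totalDeg d (component A u)) / (component A u).card

theorem potential_le {G : AdjArray n} {A : Finset (Sym2 (Fin n))} (h : PlaceInv G ∅ A) :
    potential G.deg A ≤ n := by
  have : ∀ u ∈ Finset.univ, Real.sqrt (totalDeg G.deg (component A u)) / (component A u).card ≤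
      (1 : ℝ) := by
    intro u _
    rw [div_le_one (by exact_mod_cast component_card_pos A u), Real.sqrt_le_left (by positivity)]
    exact_mod_cast h.placed.totalDeg_le u (Finset.notMem_empty u)
  simpa [potential] using Finset.sum_le_card_nsmul _ _ _ this

theorem sum_component (d : Fin n → ℕ) (A : Finset (Sym2 (Fin n))) (a : Fin n) :
    ∑ u ∈ component A a, Real.sqrt (totalDeg d (component A u)) / (component A u).card =
      Real.sqrt (totalDeg d (component A a)) := by
  have h0 : ((component A a).card : ℝ) ≠ 0 := by exact_mod_cast (component_card_pos A a).ne'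
  rw [Finset.sum_congr rfl fun u hu => by rw [component_eq_of_mem hu], Finset.sum_const,
    nsmul_eq_mul, mul_div_cancel₀ _ h0]

theorem sqrt_totalDeg_le_potential (d : Fin n → ℕ) (A : Finset (Sym2 (Fin n))) (a : Fin n) :
    Real.sqrt (totalDeg d (component A a)) ≤ potential d A := by
  rw [← sum_component]
  exact Finset.sum_le_sum_of_subset_of_nonneg (Finset.subset_univ _) fun _ _ _ => by positivity

/-- Equivalent to √(a+b) ≤ √a/2 + √b; the square of the right side is a/4 + √(ab) + b, and √(ab) ≥
a. -/
theorem sqrt_add_le {a b : ℝ} (ha : 0 ≤ a) (hab : a ≤ b) :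
    Real.sqrt (a + b) + Real.sqrt a / 2 ≤ Real.sqrt a + Real.sqrt b := by
  have h1 := Real.mul_self_sqrt ha
  have h2 := Real.mul_self_sqrt (ha.trans hab)
  have h3 := Real.sqrt_le_sqrt hab
  have h4 := Real.sqrt_nonneg a
  have h5 : Real.sqrt (a + b) ≤ Real.sqrt a / 2 + Real.sqrt b := by
    rw [Real.sqrt_le_left (by positivity)]
    nlinarith
  linarith

theorem potential_insert (d : Fin n → ℕ) {A : Finset (Sym2 (Fin n))} {a b : Fin n}
    (hb : b ∉ component A a)
    (hle : totalDeg d (component A a) ≤ totalDeg d (component A b)) :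
    potential d (insert s(a, b) A) + Real.sqrt (totalDeg d (component A a)) / 2 ≤
      potential d A := by
  have hdisj := disjoint_component hb
  -- Only the terms over the two merged components change. There the weights 1/|C| add up to 1, so
  -- each component contributes exactly its square root.
  rw [potential, potential, ← Finset.sum_add_sum_compl (component A a ∪ component A b),
    ← Finset.sum_add_sum_compl (component A a ∪ component A b)
      (fun u => Real.sqrt (totalDeg d (component A u)) / (component A u).card),
    Finset.sum_union hdisj (f := fun u =>
      Real.sqrt (totalDeg d (component A u)) / (component A u).card), sum_component,
    sum_component, ← component_insert_left, sum_component, component_insert_left,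
    totalDeg_union hdisj]
  have hrest : ∀ u ∈ (component A a ∪ component A b)ᶜ,
      component (insert s(a, b) A) u = component A u := by
    intro u hu
    rw [Finset.mem_compl, Finset.mem_union, not_or, mem_component_comm,
      mem_component_comm (v := b)] at hu
    exact component_insert_of_notMem hu.1 hu.2
  rw [Finset.sum_congr rfl fun u hu => by rw [hrest u hu]]
  have := sqrt_add_le (Nat.cast_nonneg (α := ℝ) (totalDeg d (component A a)))
    (Nat.cast_le.2 hle)
  push_cast
  linarith

end Potential

/-! ### The cost of one search. -/

/-- A bound on the expected remaining cost at the beginning of round `r` of a search among `N`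
cells. -/
noncomputable def searchCost (N r : ℕ) : ℝ :=
  24 * Real.sqrt N +
    if (6 / 5 : ℝ) ^ r < Real.sqrt N then 36 * Real.sqrt N - 30 * (6 / 5 : ℝ) ^ r else 0

theorem searchCost_nonneg (N r : ℕ) : 0 ≤ searchCost N r := by
  rw [searchCost]
  have := Real.sqrt_nonneg N
  split_ifs <;> linarith

theorem searchCost_zero_le {N : ℕ} (hN : 0 < N) : searchCost N 0 + 1 ≤ 61 * Real.sqrt N := by
  have h1 : 1 ≤ Real.sqrt N := Real.one_le_sqrt.2 (by exact_mod_cast hN)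
  rw [searchCost]
  split_ifs <;> linarith [pow_zero (6 / 5 : ℝ)]

/-- A late round costs at most 4 + 2√N ≤ 6√N and fails with probability at most 3/4; 24√N is the
fixed point of x = 6√N + 3x/4. -/
theorem searchCost_step_late {N r : ℕ} (hN : 0 < N) (h : Real.sqrt N ≤ (6 / 5 : ℝ) ^ r) :
    4 + 2 * roundBound N r + 3 / 4 * searchCost N (r + 1) ≤ searchCost N r := by
  have h1 : 1 ≤ Real.sqrt N := Real.one_le_sqrt.2 (by exact_mod_cast hN)
  have h2 : Real.sqrt N ≤ (6 / 5 : ℝ) ^ (r + 1) := by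
    rw [pow_succ]
    linarith
  rw [searchCost, searchCost, if_neg h.not_gt, if_neg h2.not_gt, roundBound, min_eq_right h]
  linarith

/-- No success is assumed. The round costs at most 6(6/5)^r, which is the increment of 30(6/5)^r
from r to r + 1. At the passage to the late rounds, 36√N covers 6(6/5)^r + 30(6/5)^r. -/
theorem searchCost_step_early {N r : ℕ} (h : (6 / 5 : ℝ) ^ r < Real.sqrt N) :
    4 + 2 * roundBound N r + searchCost N (r + 1) ≤ searchCost N r := by
  have h1 : (1 : ℝ) ≤ (6 / 5) ^ r := one_le_pow₀ (by norm_num)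
  rw [searchCost, searchCost, if_pos h, roundBound, min_eq_left h.le, pow_succ]
  split_ifs <;> linarith

variable {n : ℕ} {G : AdjArray n}

/-- The part of the potential that is left after the search for an edge out of `C`. -/
noncomputable def base (d : Fin n → ℕ) (A : Finset (Sym2 (Fin n))) (C : Finset (Fin n)) : ℝ≥0∞ :=
  ENNReal.ofReal (122 * potential d A - 61 * Real.sqrt (totalDeg d C))

open Classical in
/-- The bound used when the cell `x` is to be checked. -/
noncomputable def checkBound (G : AdjArray n) (A : Finset (Sym2 (Fin n))) (C : Finset (Fin n))
    (r : ℕ) (x : Cell G.deg) : ℝ≥0∞ :=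
  base G.deg A C + 2 + (if G.oracle x ∈ C then 1 else 0) *
    ENNReal.ofReal (searchCost (totalDeg G.deg C) (r + 1))

theorem expect_checkBound (A : Finset (Sym2 (Fin n))) (C : Finset (Fin n)) (r j : ℕ)
    (h : 0 < totalDeg G.deg C) :
    (((groverCircuit G.deg C h j).outcome G.oracle).expect fun z => checkBound G A C r z.1) =
      base G.deg A C + 2 + Grover.failProb G.oracle C h j *
        ENNReal.ofReal (searchCost (totalDeg G.deg C) (r + 1)) := by
  simp only [checkBound]
  rw [PMF.expect_add, PMF.expect_const, PMF.expect_mul_right]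
  congr!

theorem totalDeg_pos_of_marked {f : Cell G.deg → Fin n} {C : Finset (Fin n)}
    (h : 0 < Grover.markedCount f C) : 0 < totalDeg G.deg C := by
  have := Grover.markedCount_add_unmarkedCount f C
  omega

/-! ### The Lyapunov function of the whole algorithm. -/

variable [NeZero n]

/-- A bound on the expected remaining cost, where each query and each step has cost one. -/
noncomputable def costBound (G : AdjArray n) : CState G.deg → ℝ≥0∞
  | .place S A => (stepsLeft (.place S A : CState G.deg) +
      queriesLeft (.place S A : CState G.deg) : ℕ) + 122 * n
  | .scan S A v D j => (stepsLeft (.scan S A v D j : CState G.deg) +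
      queriesLeft (.scan S A v D j : CState G.deg) : ℕ) + 122 * n
  | .loop A => ENNReal.ofReal (122 * potential G.deg A)
  | .search A C r => base G.deg A C + ENNReal.ofReal (searchCost (totalDeg G.deg C) r)
  | .grover A C r j => 1 + 2 * j +
      if h : 0 < totalDeg G.deg C then
        ((groverCircuit G.deg C h j).outcome G.oracle).expect fun z => checkBound G A C r z.1
      else 0
  | .check A C r x => checkBound G A C r x

open Classical in
/-- One for every step that is not a halting step, and one for every query. -/
noncomputable def cost (G : AdjArray n) (c : CState G.deg) : ℝ≥0∞ :=
  (connectivityAlgorithm G.deg).queries c +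
    if (connectivityAlgorithm G.deg).Halted c then 0 else 1

theorem cost_le (c : CState G.deg) {q : ℕ} (hq : (connectivityAlgorithm G.deg).queries c = q) :
    cost G c ≤ q + 1 := by
  rw [cost, hq]
  gcongr
  split_ifs <;> simp

theorem one_le_cost (c : CState G.deg) (hc : ¬ (connectivityAlgorithm G.deg).Halted c) :
    1 ≤ cost G c := by
  rw [cost, if_neg hc]
  exact le_add_self

/-- A walk from `u` to a vertex outside its component must cross the boundary, and the crossing edge
occupies a marked cell. -/
theorem exists_marked (hG : G.graph.Connected) {A : Finset (Sym2 (Fin n))}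
    (hA : ¬ (edgeGraph A).Connected) (u : Fin n) :
    0 < Grover.markedCount G.oracle (component A u) := by
  obtain ⟨v, hv⟩ : ∃ v, v ∉ component A u := by
    by_contra! h
    refine hA ⟨fun x y => ?_⟩
    exact (mem_component.1 (h x)).symm.trans (mem_component.1 (h y))
  obtain ⟨p⟩ := hG.preconnected u v
  obtain ⟨e, -, h1, h2⟩ := p.exists_boundary_dart (component A u : Set (Fin n))
    (self_mem_component A u) hv
  obtain ⟨j, hj⟩ := e.adj
  exact Finset.card_pos.2 ⟨⟨e.fst, j⟩, Finset.mem_filter.2 ⟨Finset.mem_univ _, h1, by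
    rw [AdjArray.oracle]
    exact hj ▸ h2⟩⟩

theorem search_step (A : Finset (Sym2 (Fin n))) (C : Finset (Fin n)) (r : ℕ)
    (h : 0 < totalDeg G.deg C) (hmark : 0 < Grover.markedCount G.oracle C) :
    1 + (nextLaw G (.search A C r)).expect (costBound G) ≤ costBound G (.search A C r) := by
  set N := totalDeg G.deg C with hN
  set b := roundBound N r with hb
  set w := ENNReal.ofReal (searchCost N (r + 1)) with hw
  have hne := range_roundBound_nonempty h r
  have hm0 : ((⌈b⌉₊ : ℕ) : ℝ≥0∞) ≠ 0 := by
    exact_mod_cast (Finset.nonempty_range_iff.1 hne)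
  have hmt : ((⌈b⌉₊ : ℕ) : ℝ≥0∞) ≠ ∞ := ENNReal.natCast_ne_top _
  have hb0 : 0 ≤ b := by
    rw [hb, roundBound]
    positivity
  have hterm : ∀ j ∈ Finset.range ⌈b⌉₊, costBound G (.grover A C r j) ≤
      base G.deg A C + 3 + ENNReal.ofReal (2 * b) + Grover.failProb G.oracle C h j * w := by
    intro j hj
    have hjb : (2 * j : ℝ≥0∞) ≤ ENNReal.ofReal (2 * b) := by
      rw [← ENNReal.ofReal_natCast, ← ENNReal.ofReal_ofNat, ← ENNReal.ofReal_mul two_pos.le]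
      apply ENNReal.ofReal_le_ofReal
      have := Nat.lt_ceil.1 (Finset.mem_range.1 hj)
      linarith
    rw [costBound, dif_pos h, expect_checkBound]
    calc (1 + 2 * j + (base G.deg A C + 2 + Grover.failProb G.oracle C h j * w) : ℝ≥0∞)
        = base G.deg A C + (1 + 2) + 2 * j + Grover.failProb G.oracle C h j * w := by ring
      _ ≤ _ := by
        gcongr
        norm_num
  have hexp : (nextLaw G (.search A C r)).expect (costBound G) ≤
      base G.deg A C + 3 + ENNReal.ofReal (2 * b) +
        (((⌈b⌉₊ : ℕ) : ℝ≥0∞)⁻¹ * ∑ j ∈ Finset.range ⌈b⌉₊, Grover.failProb G.oracle C h j) * w := by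
    rw [next_search_of_pos h, PMF.expect_map, PMF.expect_uniformOfFinset, Finset.card_range]
    refine le_trans (mul_le_mul_right (Finset.sum_le_sum hterm) _) (le_of_eq ?_)
    rw [Finset.sum_add_distrib, Finset.sum_const, Finset.card_range, nsmul_eq_mul, mul_add,
      ← mul_assoc, ENNReal.inv_mul_cancel hm0 hmt, one_mul, ← Finset.sum_mul, mul_assoc]
  -- Here q bounds the average failure probability of the round: 3/4 once (6/5)^r has reached √N,
  -- and trivially 1 before. The constant 4 is one step each for drawing j, for the circuit and for
  -- the check, plus the classical query.
  have hfinal : ∀ q : ℝ, 0 ≤ q → 4 + 2 * b + q * searchCost N (r + 1) ≤ searchCost N r →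
      ((⌈b⌉₊ : ℕ) : ℝ≥0∞)⁻¹ * ∑ j ∈ Finset.range ⌈b⌉₊, Grover.failProb G.oracle C h j ≤
        ENNReal.ofReal q →
      1 + (nextLaw G (.search A C r)).expect (costBound G) ≤ costBound G (.search A C r) := by
    intro q hq0 hq hfail
    calc 1 + (nextLaw G (.search A C r)).expect (costBound G)
        ≤ 1 + (base G.deg A C + 3 + ENNReal.ofReal (2 * b) + ENNReal.ofReal q * w) := by
          gcongr
          exact hexp.trans (by gcongr)
      _ = base G.deg A C + ((1 + 3) + ENNReal.ofReal (2 * b) + ENNReal.ofReal q * w) := by ring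
      _ = base G.deg A C + ENNReal.ofReal (4 + 2 * b + q * searchCost N (r + 1)) := by
          rw [ENNReal.ofReal_add (by positivity) (mul_nonneg hq0 (searchCost_nonneg _ _)),
            ENNReal.ofReal_add (by norm_num) (by positivity), ENNReal.ofReal_mul hq0,
            ENNReal.ofReal_ofNat, ← hw]
          norm_num
      _ ≤ _ := by
          rw [costBound]
          gcongr
  by_cases hlate : Real.sqrt N ≤ (6 / 5 : ℝ) ^ r
  · refine hfinal (3 / 4) (by norm_num) (searchCost_step_late h hlate) ?_
    have hceil : Real.sqrt N ≤ (⌈b⌉₊ : ℕ) := by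
      have : b = Real.sqrt N := by rw [hb, roundBound, min_eq_right hlate]
      rw [← this]
      exact Nat.le_ceil b
    rw [mul_comm, ← div_eq_mul_inv]
    refine ENNReal.div_le_of_le_mul ?_
    rw [← ENNReal.ofReal_natCast, ← ENNReal.ofReal_mul (by norm_num)]
    exact Grover.sum_failProb_le _ _ h hmark _ hceil
  · refine hfinal 1 one_pos.le ?_ ?_
    · rw [one_mul]
      exact searchCost_step_early (not_le.1 hlate)
    · rw [mul_comm, ← div_eq_mul_inv, ENNReal.ofReal_one]
      refine ENNReal.div_le_of_le_mul ?_
      simpa using Finset.sum_le_card_nsmul (Finset.range ⌈b⌉₊) _ _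
        fun j _ => Grover.failProb_le_one G.oracle C h j

theorem costBound_step (hG : G.graph.Connected) (c : CState G.deg) (hc : Inv G c) :
    cost G c + (nextLaw G c).expect (costBound G) ≤ costBound G c := by
  have nat_case : ∀ {q a a' : ℕ}, q + 1 + a' ≤ a →
      (q : ℝ≥0∞) + 1 + (a' + 122 * n) ≤ a + 122 * n := by
    intro q a a' h
    rw [← add_assoc]
    gcongr
    exact_mod_cast h
  cases c with
  | place S A =>
    refine le_trans (add_le_add_left (cost_le _ queries_place) _) ?_
    by_cases hS : S.Nonempty
    · rw [next_place_of_nonempty hS, PMF.expect_pure]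
      refine nat_case ?_
      simp only [stepsLeft, queriesLeft]
      omega
    · rw [next_place_of_empty hS, PMF.expect_pure]
      rw [Finset.not_nonempty_iff_eq_empty] at hS
      subst hS
      have := potential_le hc
      simp only [costBound, stepsLeft, queriesLeft]
      have h2 : ENNReal.ofReal (122 * potential G.deg A) ≤ 122 * n := by
        rw [← ENNReal.ofReal_natCast, ← ENNReal.ofReal_ofNat, ← ENNReal.ofReal_mul (by norm_num)]
        exact ENNReal.ofReal_le_ofReal (by linarith)
      simpa using add_le_add_right h2 1
  | scan S A v D j =>
    have hcard := ScanInv.card_sdiff hc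
    by_cases hj : j < G.deg v
    · refine le_trans (add_le_add_left (cost_le _ (queries_scan_of_lt hj)) _) ?_
      by_cases hw : G.nbr v ⟨j, hj⟩ ∈ S
      · have hcard' := (ScanInv.step hc hj hw).card_sdiff
        rw [next_scan_of_mem hj hw, PMF.expect_pure]
        refine nat_case ?_
        simp only [stepsLeft, queriesLeft]
        omega
      · rw [next_scan_of_notMem hj hw, PMF.expect_pure]
        refine nat_case ?_
        simp only [stepsLeft, queriesLeft]
        omega
    · refine le_trans (add_le_add_left (cost_le _ (queries_scan_of_not_lt hj)) _) ?_
      rw [next_scan_of_not_lt hj, PMF.expect_pure]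
      refine nat_case ?_
      simp only [stepsLeft, queriesLeft]
      omega
  | loop A =>
    have hq : (connectivityAlgorithm G.deg).queries (.loop A) = 0 := by
      by_cases hA : (edgeGraph A).Connected <;>
        simp [QAlgorithm.queries, connectivityAlgorithm, connectivityAction, hA]
    by_cases hA : (edgeGraph A).Connected
    · have hh : (connectivityAlgorithm G.deg).Halted (.loop A) :=
        ⟨A, by simp [connectivityAlgorithm, connectivityAction, hA]⟩
      rw [next_loop_of_connected hA, PMF.expect_pure, cost, if_pos hh, hq]
      simp
    · refine le_trans (add_le_add_left (cost_le _ hq) _) ?_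
      rw [next_loop_of_not_connected hA, PMF.expect_pure, costBound, costBound, base]
      have hpos : 0 < totalDeg G.deg (lightestComponent G.deg A) :=
      totalDeg_pos_of_marked (f := G.oracle) (exists_marked hG hA _)
      -- The search and the step at the loop head cost at most 61√m_C. Together with `base` this is
      -- at most 122Φ; the factor 122 = 2 · 61 appears because a merge frees only half of √m_C.
      have h1 := searchCost_zero_le hpos
      have h2 : Real.sqrt (totalDeg G.deg (lightestComponent G.deg A)) ≤ potential G.deg A :=
        sqrt_totalDeg_le_potential G.deg A _
      have h3 := Real.sqrt_nonneg (totalDeg G.deg (lightestComponent G.deg A))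
      rw [← ENNReal.ofReal_add (by linarith) (searchCost_nonneg _ _), Nat.cast_zero, zero_add,
        ← ENNReal.ofReal_one, ← ENNReal.ofReal_add one_pos.le
          (add_nonneg (by linarith) (searchCost_nonneg _ _))]
      exact ENNReal.ofReal_le_ofReal (by linarith)
  | search A C r =>
    obtain ⟨-, hA, rfl⟩ := hc
    have hmark : 0 < Grover.markedCount G.oracle (lightestComponent G.deg A) :=
      exists_marked hG hA _
    have hpos := totalDeg_pos_of_marked hmark
    have hq : (connectivityAlgorithm G.deg).queries
        (.search A (lightestComponent G.deg A) r) = 0 := by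
      simp [QAlgorithm.queries, connectivityAlgorithm, connectivityAction, hpos]
    refine le_trans (add_le_add_left (cost_le _ hq) _) ?_
    simpa using search_step A _ r hpos hmark
  | grover A C r j =>
    obtain ⟨-, hA, rfl⟩ := hc
    have hpos : 0 < totalDeg G.deg (lightestComponent G.deg A) :=
      totalDeg_pos_of_marked (f := G.oracle) (exists_marked hG hA _)
    have hq : (connectivityAlgorithm G.deg).queries
        (.grover A (lightestComponent G.deg A) r j) = 2 * j := by
      simp [QAlgorithm.queries, connectivityAlgorithm, connectivityAction, hpos,
        Grover.queries_groverCircuit]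
    refine le_trans (add_le_add_left (cost_le _ hq) _) ?_
    rw [next_grover_of_pos hpos, PMF.expect_map, costBound, dif_pos hpos]
    -- Equality, since the bound at this state is the charge of the step plus the exact expectation
    -- of the bound at the check.
    refine le_of_eq ?_
    simp only [costBound]
    push_cast
    ring
  | check A C r x =>
    obtain ⟨-, hA, rfl, hx⟩ := hc
    refine le_trans (add_le_add_left (cost_le (q := 1) _ rfl) _) ?_
    rw [Nat.cast_one, one_add_one_eq_two]
    by_cases hw : G.oracle x ∈ lightestComponent G.deg A
    · rw [next_check_of_mem hw, PMF.expect_pure]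
      refine le_of_eq ?_
      simp only [costBound, checkBound, if_pos hw]
      ring
    · rw [next_check_of_notMem hw, PMF.expect_pure]
      simp only [costBound, checkBound, if_neg hw, zero_mul, add_zero, base]
      rw [add_comm]
      gcongr
      have hcomp := lightestComponent_eq G.deg A hx
      have h1 := potential_insert G.deg (A := A) (a := x.1) (b := G.oracle x) (by rwa [hcomp])
        (by rw [hcomp]; exact totalDeg_lightestComponent_le _ _ _)
      rw [hcomp] at h1
      linarith

theorem costBound_start_le (G : AdjArray n) :
    costBound G (connectivityAlgorithm G.deg).start ≤ (127 : ℕ) * n := by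
  have hn : 1 ≤ n := Nat.one_le_iff_ne_zero.2 (NeZero.ne n)
  have : costBound G (connectivityAlgorithm G.deg).start =
      ((3 * n + 1 + n + 122 * n : ℕ) : ℝ≥0∞) := by
    simp [connectivityAlgorithm, costBound, stepsLeft, queriesLeft]
  rw [this]
  -- The preprocessing contributes 4n + 1 and the potential 122n; n ≥ 1 absorbs the extra 1.
  exact_mod_cast (by omega : 3 * n + 1 + n + 122 * n ≤ 127 * n)

theorem tsum_cost_le (hG : G.graph.Connected) :
    ∑' t, ((connectivityAlgorithm G.deg).law G.oracle t).expect (cost G) ≤ (127 : ℕ) * n :=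
  le_trans (QAlgorithm.tsum_expect_le (connectivityAlgorithm G.deg) G.oracle (Inv G) inv_start
    inv_next (cost G) (costBound G) (costBound_step hG)) (costBound_start_le G)

end Connectivity

theorem mainTheorem5 :
    ∃ c : ℕ, ∀ (n : ℕ) [NeZero n] (G : AdjArray n),
      -- The preprocessing.
      (∃ (t : ℕ) (A : Finset (Sym2 (Fin n))),
        (connectivityAlgorithm G.deg).law G.oracle t = PMF.pure (CState.loop A) ∧
        (∀ s < t, ∀ x ∈ ((connectivityAlgorithm G.deg).law G.oracle s).support,
          (connectivityAlgorithm G.deg).ClassicalAt x) ∧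
        ∑ s ∈ Finset.range t, (connectivityAlgorithm G.deg).stepQueries G.oracle s ≤ n ∧
        (A : Set (Sym2 (Fin n))) ⊆ G.graph.edgeSet ∧
        ∀ u, totalDeg G.deg (component A u) ≤ (component A u).card ^ 2) ∧
      -- On a connected graph.
      (G.graph.Connected →
        (connectivityAlgorithm G.deg).outputProb G.oracle {A | IsSpanningTree G.graph A} = 1 ∧
        (connectivityAlgorithm G.deg).expectedQueries G.oracle ≤ c * n) ∧
      -- On a disconnected graph.
      (¬ G.graph.Connected →
        ∀ t, (connectivityAlgorithm G.deg).haltProb G.oracle Set.univ t = 0) := by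
  refine ⟨127, fun n _ G => ⟨?_, fun hG => ⟨?_, ?_⟩, Connectivity.haltProb_eq_zero⟩⟩
  · obtain ⟨t, A, -, hlaw, hclass, hsum, hA⟩ := Connectivity.reachesLoop (G := G) _ 0
      (.place Finset.univ ∅) le_rfl (Connectivity.placeInv_start G)
      (by simp [Connectivity.stepsLeft]) rfl
    refine ⟨t, A, hlaw, fun s hs => hclass s (Nat.zero_le s) hs, ?_, hA.forest.subset,
      fun u => hA.placed.totalDeg_le u (Finset.notMem_empty u)⟩
    simpa [Connectivity.queriesLeft] using hsum
  · refine QAlgorithm.outputProb_eq_one (connectivityAlgorithm G.deg) G.oracle _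
      (Connectivity.Inv G) Connectivity.inv_start Connectivity.inv_next (fun c hc B hB => ?_)
      (Connectivity.cost G) (fun c hc => ?_)
      (ne_top_of_le_ne_top ?_ (Connectivity.tsum_cost_le hG))
    · obtain ⟨hF, hconn⟩ := Connectivity.inv_halt c hc B hB
      exact Connectivity.Forest.isSpanningTree hF hconn
    · exact Connectivity.one_le_cost c hc
    · exact ENNReal.mul_ne_top (ENNReal.natCast_ne_top _) (ENNReal.natCast_ne_top _)
  · exact (QAlgorithm.expectedQueries_le _ _ (Connectivity.cost G) fun c => le_self_add).trans
      (Connectivity.tsum_cost_le hG)
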